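/- Let $N=3M-1$ with $M\ge 1$ an integer, $M_1=(N-2)/3$, $M_2=(N+1)/3$, and let $\eta_\alpha=\exp(2\pi i\alpha/N)$, $\alpha=1,\dots,N$, be the sites of a periodic chain. Each site carries one particle of color blue (b), red (r) or green (g), so the state space is $(\mathbb C^3)^{\otimes N}$. Let $e_\alpha^{\sigma\tau}$ be the operator that changes the color at site $\alpha$ from $\tau$ to $\sigma$ (and annihilates basis states whose color at $\alpha$ is not $\tau$), let $J_\alpha^a=\frac12\sum_{\sigma,\tau}\lambda^a_{\sigma\tau}e_\alpha^{\sigma\tau}$ with the Gell-Mann matrices $\lambda^1,\dots,\lambda^8$, and let $$H=\Bigl(\frac{2\pi}{N}\Bigr)^2\sum_{\alpha<\beta}\frac{\sum_{a=1}^8 J_\alpha^aJ_\beta^a}{|\eta_\alpha-\eta_\beta|^2}$$ be the SU(3) Haldane--Shastry Hamiltonian. A wave function $\Psi[z_1,\dots,z_{M_1};w_1,\dots,w_{M_2}]$ that is symmetric in the $z_i$ and symmetric in the $w_k$ represents the state $$|\Psi\rangle=\sum_{\{z_i,w_k\}}\Psi[z_i;w_k]\,e_{z_1}^{bg}\cdots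 e_{z_{M_1}}^{bg}\,e_{w_1}^{rg}\cdots e_{w_{M_2}}^{rg}\,|0_g\rangle ,$$ where $|0_g\rangle$ is the state with all sites green and the sum runs over all ways to place the $M_1$ blue and the $M_2$ red particles on the sites. It has momentum $p$ (modulo $2\pi$) if $\Psi[\eta_1z_i;\eta_1w_k]=e^{ip}\,\Psi[z_i;w_k]$. Define $$\Psi_0[z_i;w_k]=\prod_{i<j}^{M_1}(z_i-z_j)^2\prod_{k<l}^{M_2}(w_k-w_l)^2\prod_{i=1}^{M_1}\prod_{k=1}^{M_2}(z_i-w_k)\prod_{i=1}^{M_1}z_i\prod_{k=1}^{M_2}w_k,$$ $$\Psi_n[z_i;w_k]=\frac1N\sum_{\gamma=1}^N(\bar\eta_\gamma)^n\prod_{i=1}^{M_1}(\eta_\gamma-z_i)\,\Psi_0[z_i;w_k].$$ Then, for $0\le n\le M_1$, the state $|\Psi_n\rangle$ is an exact eigenstate of $H$ (in particular it is nonzero). Its momentum is $$p=\frac{4\pi}{3}-\frac{2\pi}{N}\Bigl(n+\frac13\Bigr)$$ and its energy is $$E_n=E_0+\frac29\frac{\pi^2}{N^2}+\frac34\Bigl(\frac{\pi^2}{9}-(p-\pi)^2\Bigr)=-\frac{\pi^2}{18}\Bigl(N+\frac1N+\frac{2}{N^2}\Bigr)+\frac{3\pi^2}{N^2}(M_1-n)\,n,$$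 where $E_0=-\frac{\pi^2}{18}\bigl(N+\frac7N\bigr)$. For $M_1<n<N$ the wave function $\Psi_n$ vanishes identically. -/

import Mathlib

open scoped Nat

namespace HaldaneShastry

noncomputable section

/-- The three colors, in the order blue, red, green (the order of the rows and columns of the
Gell-Mann matrices). -/
abbrev Color := Fin 3

/-- Blue. -/
abbrev blue : Color := 0
/-- Red. -/
abbrev red : Color := 1
/-- Green. -/
abbrev green : Color := 2

/-- The position `η_α = exp (2 π i α / N)` of the site `α` of the chain of `N` sites on the unit
circle. The sites are labelled `α = 0, …, N - 1` (the site `0` is the site usually called `N`,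
because `η_N = η_0 = 1`). -/
def eta (N : ℕ) (α : Fin N) : ℂ :=
  Complex.exp (2 * Real.pi * Complex.I * ((α : ℕ) : ℂ) / N)

/-- `η_1 = exp (2 π i / N)`, the translation by one site. -/
def eta1 (N : ℕ) : ℂ := Complex.exp (2 * Real.pi * Complex.I / N)

/-- The state space `(ℂ³)^{⊗ N}` of a chain with exactly one particle on each site: the complex
functions on the color configurations `s`, where `f s` is the amplitude of the basis vector `|s⟩`. -/
abbrev State (N : ℕ) := (Fin N → Color) → ℂ

/-- The colorflip operator `e_α^{σ τ}`: it sends the basis vector `|s⟩` to the basis vector in which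
the color of the site `α` is replaced by `σ` if `s α = τ`, and to `0` if `s α ≠ τ`. -/
def colorFlip {N : ℕ} (α : Fin N) (σ τ : Color) : Module.End ℂ (State N) where
  toFun f := fun s => if s α = σ then f (Function.update s α τ) else 0
  map_add' f g := by
    funext s
    by_cases h : s α = σ <;> simp [h]
  map_smul' c f := by
    funext s
    by_cases h : s α = σ <;> simp [h]

/-- The colorflip operator on basis vectors. -/
theorem colorFlip_single {N : ℕ} (α : Fin N) (σ τ : Color) (s : Fin N → Color) :
    colorFlip α σ τ (Pi.single s 1) =
      if s α = τ then Pi.single (Function.update s α σ) 1 else 0 := by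
  funext t
  have key : (t α = σ ∧ Function.update t α τ = s) ↔
      (s α = τ ∧ t = Function.update s α σ) := by
    constructor
    · rintro ⟨h1, h2⟩
      subst h2
      subst h1
      simp
    · rintro ⟨h1, h2⟩
      subst h2
      subst h1
      simp
  have e1 : colorFlip α σ τ (Pi.single s 1) t =
      if (t α = σ ∧ Function.update t α τ = s) then 1 else 0 := by
    by_cases h : t α = σ <;> simp [colorFlip, h, Pi.single_apply]
  have e2 : (if s α = τ then (Pi.single (Function.update s α σ) 1 : State N) else 0) t =
      if (s α = τ ∧ t = Function.update s α σ) then 1 else 0 := by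
    by_cases h : s α = τ <;> simp [h, Pi.single_apply]
  rw [e1, e2]
  simp only [key]

/-- The Gell-Mann matrices `λ^1, …, λ^8`. -/
def gellMann : Fin 8 → Matrix Color Color ℂ :=
  ![!![0, 1, 0; 1, 0, 0; 0, 0, 0],
    !![0, -Complex.I, 0; Complex.I, 0, 0; 0, 0, 0],
    !![1, 0, 0; 0, -1, 0; 0, 0, 0],
    !![0, 0, 1; 0, 0, 0; 1, 0, 0],
    !![0, 0, -Complex.I; 0, 0, 0; Complex.I, 0, 0],
    !![0, 0, 0; 0, 0, 1; 0, 1, 0],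
    !![0, 0, 0; 0, 0, -Complex.I; 0, Complex.I, 0],
    ((Real.sqrt 3 : ℂ)⁻¹) • !![1, 0, 0; 0, 1, 0; 0, 0, -2]]

/-- The component `J_α^a = (1/2) ∑_{σ τ} λ^a_{σ τ} e_α^{σ τ}` of the SU(3) spin at the site `α`. -/
def spin {N : ℕ} (α : Fin N) (a : Fin 8) : Module.End ℂ (State N) :=
  (1 / 2 : ℂ) • ∑ σ : Color, ∑ τ : Color, gellMann a σ τ • colorFlip α σ τ

/-- The SU(3) Haldane-Shastry Hamiltonian
`(2 π / N)² ∑_{α < β} J_α · J_β / |η_α - η_β|²`. -/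
def hamiltonian (N : ℕ) : Module.End ℂ (State N) :=
  (((2 * Real.pi / N) ^ 2 : ℝ) : ℂ) •
    ∑ α : Fin N, ∑ β : Fin N with α < β,
      ((1 / ‖eta N α - eta N β‖ ^ 2 : ℝ) : ℂ) • ∑ a : Fin 8, spin α a * spin β a

/-- The reference state `|0_g⟩`: all sites are green. -/
def greenState (N : ℕ) : State N := Pi.single (fun _ => green) 1

/-- The ket of a wave function `Ψ[z; w]` of `M₁` blue and `M₂` red particles,
`∑_{z, w} Ψ[z; w] e_{z_1}^{bg} ⋯ e_{z_{M₁}}^{bg} e_{w_1}^{rg} ⋯ e_{w_{M₂}}^{rg} |0_g⟩`,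
where the sum extends over all ways to distribute the blue and the red particles over the sites.
The sum below runs over ordered tuples of sites; for a wave function that is symmetric in the `z_i`
and in the `w_k` the prefactor makes each distribution count once (tuples in which a site occurs
twice contribute `0`, because the product of colorflips kills `|0_g⟩`). -/
def ket (N : ℕ) {M₁ M₂ : ℕ} (Ψ : (Fin M₁ → ℂ) → (Fin M₂ → ℂ) → ℂ) : State N :=
  (1 / ((M₁ ! : ℂ) * (M₂ ! : ℂ))) •
    ∑ z : Fin M₁ → Fin N, ∑ w : Fin M₂ → Fin N,
      Ψ (fun i => eta N (z i)) (fun k => eta N (w k)) •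
        ((List.ofFn fun i => colorFlip (z i) blue green).prod *
          (List.ofFn fun k => colorFlip (w k) red green).prod) (greenState N)

/-- The wave function `Ψ₀[z; w] = ∏_{i<j} (z_i - z_j)² ∏_{k<l} (w_k - w_l)² ∏_{i,k} (z_i - w_k)
∏_i z_i ∏_k w_k`. -/
def psi0 {M₁ M₂ : ℕ} (z : Fin M₁ → ℂ) (w : Fin M₂ → ℂ) : ℂ :=
  (∏ i : Fin M₁, ∏ j : Fin M₁ with i < j, (z i - z j) ^ 2) *
  (∏ k : Fin M₂, ∏ l : Fin M₂ with k < l, (w k - w l) ^ 2) *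
  (∏ i : Fin M₁, ∏ k : Fin M₂, (z i - w k)) *
  (∏ i : Fin M₁, z i) * (∏ k : Fin M₂, w k)

/-- The yellow coloron localized at the site `γ`: `Ψ_γ = ∏_i (η_γ - z_i) Ψ₀`. -/
def localizedColoron (N : ℕ) {M₁ M₂ : ℕ} (γ : Fin N) (z : Fin M₁ → ℂ) (w : Fin M₂ → ℂ) : ℂ :=
  (∏ i : Fin M₁, (eta N γ - z i)) * psi0 z w

/-- The Fourier transform `Ψ_n = (1 / N) ∑_γ (conj η_γ)^n Ψ_γ`. -/
def coloron (N : ℕ) {M₁ M₂ : ℕ} (n : ℕ) (z : Fin M₁ → ℂ) (w : Fin M₂ → ℂ) : ℂ :=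
  (1 / (N : ℂ)) * ∑ γ : Fin N, (starRingEnd ℂ (eta N γ)) ^ n * localizedColoron N γ z w

/-- A wave function has momentum `p` if `Ψ[η_1 z; η_1 w] = exp (i p) Ψ[z; w]`. -/
def HasMomentum (N : ℕ) {M₁ M₂ : ℕ} (Ψ : (Fin M₁ → ℂ) → (Fin M₂ → ℂ) → ℂ) (p : ℝ) : Prop :=
  ∀ (z : Fin M₁ → ℂ) (w : Fin M₂ → ℂ),
    Ψ (fun i => eta1 N * z i) (fun k => eta1 N * w k) = Complex.exp (Complex.I * p) * Ψ z w

/-- `E₀ = -(π² / 18) (N + 7 / N)`. -/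
def groundEnergy (N : ℕ) : ℝ := -(Real.pi ^ 2 / 18) * ((N : ℝ) + 7 / N)

/-- The one-coloron momentum `p = 4 π / 3 - (2 π / N) (n + 1 / 3)`. -/
def coloronMomentum (N n : ℕ) : ℝ :=
  4 * Real.pi / 3 - (2 * Real.pi / N) * ((n : ℝ) + 1 / 3)

/-- The one-coloron dispersion relation `ε(p) = (3 / 4) (π² / 9 - (p - π)²)`. -/
def dispersion (p : ℝ) : ℝ := (3 / 4) * (Real.pi ^ 2 / 9 - (p - Real.pi) ^ 2)

/-- The one-coloron energy `E_n = E₀ + (2 / 9) π² / N² + ε(p)`. -/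
def coloronEnergy (N n : ℕ) : ℝ :=
  groundEnergy N + (2 / 9) * (Real.pi ^ 2 / (N : ℝ) ^ 2) + dispersion (coloronMomentum N n)

end

end HaldaneShastry

/-!
The coupling of two sites is a color exchange, `J_α · J_β = (P_{αβ} - 1/3) / 2`, so the eigenvalue
equation is about the sums `∑ P_{αβ} Ψ / |η_α - η_β|²` over the pairs of sites of each two colors.
It is convenient to treat all `n` at once: `Ψ_n` is the coefficient of `x ^ n` in `∏ (x - z_i) Ψ₀`
(`coloron_eq_coeff`, which also gives the momentum and the vanishing for `n > M₁`), and `x` may be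
taken away from the sites.

*Blue and red particles hopping to green sites.* As a function of the position of one particle the
wave function is a polynomial of degree less than `N` which vanishes at the sites occupied by the
other blue and red particles, so that the sum over green sites may be extended to all sites. On
polynomials of degree at most `N` the sum over all sites with the inverse square weight is a second
order differential operator (`sum_pairWeight_mul_eval`), and on a product of linear factors this
gives squares of sums of the cotangent kernels `(z + w) / (2 (z - w))`
(`sum_pairWeight_mul_eval_prod`).

*Exchange of blue and red particles.* Since `∏_{β ≠ α} (η_α - η_β) = N / η_α`, the wave function
keeps its form, up to a constant sign, if the red particles are replaced by the green ones
(`baseAmplitude_red_eq_green`). In this form the exchange is the hopping of a blue particle.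

*Sum of all terms.* The squares contain three-body terms. In the sum over the pairs of colors they
occur exactly in the symmetric combinations which the addition theorem of the cotangent turns into
constants (`sum_sq_sum_cotKernel`, `sum_cotKernel_mul_add_sum_sq`), and the two-body terms cancel
(`sum_hop_eq`). What remains beside a constant is `3 M₁ x d/dx - 3 (x d/dx)²` acting on
`∏ (x - z_i)`, which is diagonal on the coefficients of `x ^ n`
(`sum_pairWeight_mul_amplitudePoly`).

*The states are nonzero*, because for `n ≤ M₁` some choice of `M₁` sites has a nonzero coefficient
of `x ^ n` (`exists_coeff_prod_ne_zero`).
-/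

namespace HaldaneShastry

open Polynomial

/-! ### The sites and the pair weights -/

theorem eta_eq_pow (N : ℕ) (α : Fin N) : eta N α = eta1 N ^ (α : ℕ) := by
  rw [eta, eta1, ← Complex.exp_nat_mul]
  congr 1
  ring

theorem eta1_isPrimitiveRoot {N : ℕ} (hN : N ≠ 0) : IsPrimitiveRoot (eta1 N) N :=
  Complex.isPrimitiveRoot_exp N hN

theorem eta_injective (N : ℕ) : Function.Injective (eta N) := by
  intro α β h
  rw [eta_eq_pow, eta_eq_pow] at h
  exact Fin.ext ((eta1_isPrimitiveRoot (by have := α.2; omega)).pow_inj α.2 β.2 h)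

theorem eta_ne_zero (N : ℕ) (α : Fin N) : eta N α ≠ 0 := Complex.exp_ne_zero _

theorem eta_pow_card (N : ℕ) (α : Fin N) : eta N α ^ N = 1 := by
  rw [eta_eq_pow, ← pow_mul, mul_comm, pow_mul,
    (eta1_isPrimitiveRoot (by have := α.2; omega)).pow_eq_one, one_pow]

theorem norm_eta (N : ℕ) (α : Fin N) : ‖eta N α‖ = 1 :=
  Complex.norm_eq_one_of_pow_eq_one (eta_pow_card N α) (by have := α.2; omega)

theorem conj_eta (N : ℕ) (α : Fin N) : starRingEnd ℂ (eta N α) = (eta N α)⁻¹ := by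
  rw [Complex.inv_def, Complex.normSq_eq_norm_sq, norm_eta]
  simp

theorem sum_eta_pow {N k : ℕ} (hk : 0 < k) (hkN : k < N) : ∑ α : Fin N, eta N α ^ k = 0 := by
  have hp := eta1_isPrimitiveRoot (N := N) (by omega)
  have h1 : eta1 N ^ k ≠ 1 := hp.pow_ne_one_of_pos_of_lt hk.ne' hkN
  have h2 : ∀ α : Fin N, eta N α ^ k = (eta1 N ^ k) ^ (α : ℕ) := fun α => by
    rw [eta_eq_pow, ← pow_mul, ← pow_mul, mul_comm]
  simp_rw [h2]
  rw [Fin.sum_univ_eq_sum_range (fun i => (eta1 N ^ k) ^ i) N, geom_sum_eq h1, ← pow_mul,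
    mul_comm k, pow_mul, hp.pow_eq_one]
  simp

/-- The cotangent kernel `(z + w) / (2 (z - w))`; at `z = w` division by zero makes it `0`. -/
noncomputable def cotKernel (z w : ℂ) : ℂ := (z + w) / (2 * (z - w))

/-- The inverse square weight `-z w / (z - w)²`, which is `1 / |z - w|²` on the unit circle; at
`z = w` division by zero makes it `0`. -/
noncomputable def pairWeight (z w : ℂ) : ℂ := -(z * w) / (z - w) ^ 2

@[simp] theorem cotKernel_self (z : ℂ) : cotKernel z z = 0 := by simp [cotKernel]

@[simp] theorem pairWeight_self (z : ℂ) : pairWeight z z = 0 := by simp [pairWeight]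

theorem cotKernel_swap (z w : ℂ) : cotKernel w z = -cotKernel z w := by
  rw [cotKernel, cotKernel, ← div_neg, add_comm w z]
  congr 1
  ring

theorem pairWeight_comm (z w : ℂ) : pairWeight w z = pairWeight z w := by
  rw [pairWeight, pairWeight, mul_comm w z]
  congr 1
  ring

theorem pairWeight_eq {z w : ℂ} (h : z ≠ w) : pairWeight z w = 1 / 4 - cotKernel z w ^ 2 := by
  have := sub_ne_zero.mpr h
  rw [pairWeight, cotKernel]
  field_simp
  ring

/-- The addition theorem of the cotangent. -/
theorem cotKernel_triple {x y z : ℂ} (hxy : x ≠ y) (hyz : y ≠ z) (hxz : x ≠ z) :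
    cotKernel x y * cotKernel x z + cotKernel y x * cotKernel y z +
      cotKernel z x * cotKernel z y = 1 / 4 := by
  have h1 := sub_ne_zero.mpr hxy
  have h2 := sub_ne_zero.mpr hyz
  have h3 := sub_ne_zero.mpr hxz
  rw [cotKernel_swap x y, cotKernel_swap x z, cotKernel_swap y z, cotKernel, cotKernel, cotKernel]
  field_simp
  ring

theorem inv_norm_sq_eq_pairWeight (N : ℕ) (α β : Fin N) :
    ((1 / ‖eta N α - eta N β‖ ^ 2 : ℝ) : ℂ) = pairWeight (eta N α) (eta N β) := by
  by_cases h : α = β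
  · simp [h]
  have h1 : eta N α - eta N β ≠ 0 := sub_ne_zero.mpr ((eta_injective N).ne h)
  have h2 : ((‖eta N α - eta N β‖ ^ 2 : ℝ) : ℂ) =
      (eta N α - eta N β) * ((eta N α)⁻¹ - (eta N β)⁻¹) := by
    rw [← conj_eta, ← conj_eta, ← map_sub, Complex.mul_conj, Complex.normSq_eq_norm_sq]
  have h3 := eta_ne_zero N α
  have h4 := eta_ne_zero N β
  have h5 : eta N β - eta N α ≠ 0 := by rw [← neg_sub]; exact neg_ne_zero.mpr h1
  rw [Complex.ofReal_div, h2, pairWeight, Complex.ofReal_one, inv_sub_inv h3 h4]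
  field_simp
  ring

/-! ### Sum rules on the circle -/

/-- The sum over `m` is a geometric sum of a nontrivial root of unity. -/
theorem sum_range_div_pow {N : ℕ} {α β : Fin N} (h : α ≠ β) :
    ∑ m ∈ Finset.range N, (eta N β / eta N α) ^ m = 0 := by
  have h1 : eta N β / eta N α ≠ 1 := by
    rw [Ne, div_eq_one_iff_eq (eta_ne_zero N α)]
    exact (eta_injective N).ne h.symm
  rw [geom_sum_eq h1, div_pow, eta_pow_card, eta_pow_card]
  simp

theorem sum_range_mul_sub (N : ℕ) :
    ∑ m ∈ Finset.range N, ((m : ℂ) * (m - 1) / 2 - (N - 1) / 2 * m) = -(N * (N ^ 2 - 1) / 12) := by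
  have h : ∀ (n : ℕ) (a : ℂ), ∑ m ∈ Finset.range n, ((m : ℂ) * (m - 1) / 2 - a / 2 * m) =
      n * (n - 1) * (n - 2) / 6 - a * n * (n - 1) / 4 := by
    intro n a
    induction n with
    | zero => simp
    | succ n ih =>
      rw [Finset.sum_range_succ, ih]
      push_cast
      ring
  rw [h]
  ring

/-- The Fourier sums of the inverse square weight. Their second difference in `m` is constant, they
are periodic in `m`, and they add up to `0` over a period. -/
theorem sum_pairWeight_mul_pow {N : ℕ} (α : Fin N) {m : ℕ} (hm : m ≤ N) :
    ∑ β : Fin N, pairWeight (eta N α) (eta N β) * eta N β ^ m =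
      eta N α ^ m * (((N : ℂ) ^ 2 - 1) / 12 - m * (N - m) / 2) := by
  have hN : (N : ℂ) ≠ 0 := by
    have := α.2
    exact_mod_cast (by omega : N ≠ 0)
  have hα := eta_ne_zero N α
  -- Dividing by `η_α ^ m` makes the second difference equal to `1`.
  set T : ℕ → ℂ := fun m => ∑ β : Fin N, pairWeight (eta N α) (eta N β) * (eta N β / eta N α) ^ m
    with hT
  have h2 : ∀ m, m + 1 < N → T (m + 2) = 2 * T (m + 1) - T m + 1 := by
    intro m hm
    have e1 : T (m + 2) - (2 * T (m + 1) - T m) =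
        ∑ β : Fin N, (-(eta N β / eta N α) ^ (m + 1) + if α = β then 1 else 0) := by
      simp only [hT]
      rw [Finset.mul_sum, ← Finset.sum_sub_distrib, ← Finset.sum_sub_distrib]
      refine Finset.sum_congr rfl fun β _ => ?_
      by_cases h : α = β
      · subst h
        simp [hα]
      · have h1 : eta N α - eta N β ≠ 0 := sub_ne_zero.mpr ((eta_injective N).ne h)
        have h3 := eta_ne_zero N β
        rw [if_neg h, pairWeight, div_pow, div_pow, div_pow]
        field_simp
        ring
    have e2 : ∑ β : Fin N, (eta N β / eta N α) ^ (m + 1) = 0 := by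
      simp_rw [div_pow]
      rw [← Finset.sum_div, sum_eta_pow (by omega) hm, zero_div]
    rw [Finset.sum_add_distrib, Finset.sum_neg_distrib, e2] at e1
    simp only [Finset.sum_ite_eq, Finset.mem_univ, if_true] at e1
    linear_combination e1
  have h3 : ∀ m, m + 1 ≤ N → T m = T 0 + m * (T 1 - T 0) + m * (m - 1) / 2 ∧
      T (m + 1) = T 0 + (m + 1) * (T 1 - T 0) + (m + 1) * m / 2 := by
    intro m
    induction m with
    | zero => intro _; simp
    | succ k ih =>
      intro hk
      obtain ⟨i1, i2⟩ := ih (by omega)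
      refine ⟨by rw [i2]; push_cast; ring, ?_⟩
      rw [h2 k (by omega), i1, i2]
      push_cast
      ring
  have h4 : ∀ m, m ≤ N → T m = T 0 + m * (T 1 - T 0) + m * (m - 1) / 2 := by
    intro m hm
    cases m with
    | zero => simp
    | succ k => rw [(h3 k hm).2]; push_cast; ring
  -- The two remaining constants follow from periodicity and from the sum over a period.
  have h5 : T 1 - T 0 = -((N - 1) / 2) := by
    have e1 : T N = T 0 := by
      simp only [hT]
      refine Finset.sum_congr rfl fun β _ => ?_
      rw [div_pow, eta_pow_card, eta_pow_card]
      simp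
    have e2 := h4 N le_rfl
    rw [e1] at e2
    have e3 : (N : ℂ) * (T 1 - T 0 + (N - 1) / 2) = 0 := by linear_combination -e2
    have e4 := (mul_eq_zero.mp e3).resolve_left hN
    linear_combination e4
  have h6 : T 0 = ((N : ℂ) ^ 2 - 1) / 12 := by
    have e1 : ∑ m ∈ Finset.range N, T m = 0 := by
      simp only [hT]
      rw [Finset.sum_comm]
      refine Finset.sum_eq_zero fun β _ => ?_
      rw [← Finset.mul_sum]
      by_cases h : α = β
      · simp [h]
      · rw [sum_range_div_pow h, mul_zero]
    have e2 : ∑ m ∈ Finset.range N, T m =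
        ∑ m ∈ Finset.range N, (T 0 + ((m : ℂ) * (m - 1) / 2 - (N - 1) / 2 * m)) := by
      refine Finset.sum_congr rfl fun m hm => ?_
      rw [h4 m (Finset.mem_range.mp hm).le, h5]
      ring
    rw [e1, Finset.sum_add_distrib, sum_range_mul_sub, Finset.sum_const, Finset.card_range,
      nsmul_eq_mul] at e2
    have e3 : (N : ℂ) * (T 0 - ((N : ℂ) ^ 2 - 1) / 12) = 0 := by linear_combination -e2
    have e4 := (mul_eq_zero.mp e3).resolve_left hN
    linear_combination e4
  have h7 : ∑ β : Fin N, pairWeight (eta N α) (eta N β) * eta N β ^ m = eta N α ^ m * T m := by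
    simp only [hT]
    rw [Finset.mul_sum]
    refine Finset.sum_congr rfl fun β _ => ?_
    rw [div_pow]
    field_simp
  rw [h7, h4 m hm, h5, h6]
  ring

theorem sum_pairWeight {N : ℕ} (α : Fin N) :
    ∑ β : Fin N, pairWeight (eta N α) (eta N β) = ((N : ℂ) ^ 2 - 1) / 12 := by
  simpa using sum_pairWeight_mul_pow α (Nat.zero_le N)

/-- This is the difference of the Fourier sums of the weight for `m = 1` and `m = 0`. -/
theorem sum_cotKernel {N : ℕ} (α : Fin N) : ∑ β : Fin N, cotKernel (eta N α) (eta N β) = 0 := by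
  have hα := eta_ne_zero N α
  have h1 := sum_pairWeight_mul_pow α (m := 1) (by have := α.2; omega)
  have h2 := sum_pairWeight α
  have h3 : ∑ β : Fin N, cotKernel (eta N α) (eta N β) =
      ∑ β : Fin N, (pairWeight (eta N α) (eta N β) * eta N β ^ 1 / eta N α -
        pairWeight (eta N α) (eta N β) + (1 / 2 - if α = β then 1 / 2 else 0)) := by
    refine Finset.sum_congr rfl fun β _ => ?_
    by_cases h : α = β
    · simp [h]
    · have h1 : eta N α - eta N β ≠ 0 := sub_ne_zero.mpr ((eta_injective N).ne h)
      rw [if_neg h, pairWeight, cotKernel]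
      field_simp
      ring
  rw [h3, Finset.sum_add_distrib, Finset.sum_sub_distrib, Finset.sum_sub_distrib,
    ← Finset.sum_div, h1, h2]
  simp only [Finset.sum_const, Finset.card_univ, Fintype.card_fin, Finset.sum_ite_eq,
    Finset.mem_univ, if_true, nsmul_eq_mul, pow_one, Nat.cast_one]
  field_simp
  ring

/-- The Euler operator `X d/dX` on polynomials. -/
noncomputable def euler (p : ℂ[X]) : ℂ[X] := X * derivative p

theorem euler_sum {ι : Type*} (s : Finset ι) (p : ι → ℂ[X]) :
    euler (∑ i ∈ s, p i) = ∑ i ∈ s, euler (p i) := by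
  simp only [euler, derivative_sum, Finset.mul_sum]

theorem euler_C_mul (a : ℂ) (p : ℂ[X]) : euler (C a * p) = C a * euler p := by
  rw [euler, euler, derivative_C_mul]
  ring

theorem coeff_euler (p : ℂ[X]) (n : ℕ) : (euler p).coeff n = n * p.coeff n := by
  cases n with
  | zero => simp [euler]
  | succ n => rw [euler, coeff_X_mul, coeff_derivative]; push_cast; ring

theorem euler_C_mul_X_pow (a : ℂ) (n : ℕ) : euler (C a * X ^ n) = C (n * a) * X ^ n := by
  ext k
  rw [coeff_euler, coeff_C_mul_X_pow, coeff_C_mul_X_pow]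
  split_ifs with h
  · rw [h]
  · simp

/-- Hopping of one particle with the inverse square amplitude acts on a polynomial wave function of
degree at most `N` as a differential operator. -/
theorem sum_pairWeight_mul_eval {N : ℕ} (α : Fin N) {p : ℂ[X]} (hp : p.natDegree ≤ N) :
    ∑ β : Fin N, pairWeight (eta N α) (eta N β) * p.eval (eta N β) =
      ((N : ℂ) ^ 2 - 1) / 12 * p.eval (eta N α) - N / 2 * (euler p).eval (eta N α) +
        1 / 2 * (euler (euler p)).eval (eta N α) := by
  have key : ∀ q : ℂ[X], q = ∑ m ∈ Finset.range (N + 1), C (p.coeff m) * X ^ m →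
      ∑ β : Fin N, pairWeight (eta N α) (eta N β) * q.eval (eta N β) =
      ((N : ℂ) ^ 2 - 1) / 12 * q.eval (eta N α) - N / 2 * (euler q).eval (eta N α) +
        1 / 2 * (euler (euler q)).eval (eta N α) := by
    rintro q rfl
    simp only [euler_sum, euler_C_mul_X_pow, eval_finsetSum, eval_mul, eval_C, eval_pow, eval_X,
      Finset.mul_sum]
    rw [Finset.sum_comm, ← Finset.sum_sub_distrib, ← Finset.sum_add_distrib]
    refine Finset.sum_congr rfl fun m hm => ?_
    have h := sum_pairWeight_mul_pow α (m := m) (by have := Finset.mem_range.mp hm; omega)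
    have h' : ∑ β : Fin N, pairWeight (eta N α) (eta N β) * (p.coeff m * eta N β ^ m) =
        p.coeff m * ∑ β : Fin N, pairWeight (eta N α) (eta N β) * eta N β ^ m := by
      rw [Finset.mul_sum]
      exact Finset.sum_congr rfl fun β _ => by ring
    rw [h', h]
    ring
  exact key p (p.as_sum_range_C_mul_X_pow' (by omega))

/-- Logarithmic derivatives of a product of linear factors. -/
theorem euler_prod_X_sub_C (s : Multiset ℂ) (z : ℂ) (hz : ∀ r ∈ s, z ≠ r) :
    (euler (s.map fun r => X - C r).prod).eval z =
        (s.map fun r => X - C r).prod.eval z * (s.map fun r => cotKernel z r + 1 / 2).sum ∧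
    (euler (euler (s.map fun r => X - C r).prod)).eval z =
        (s.map fun r => X - C r).prod.eval z *
          ((s.map fun r => cotKernel z r + 1 / 2).sum ^ 2 +
            (s.map fun r => pairWeight z r).sum) := by
  induction s using Multiset.induction_on with
  | empty => simp [euler]
  | cons r s ih =>
    obtain ⟨i1, i2⟩ := ih fun r' h => hz r' (Multiset.mem_cons_of_mem h)
    have hr : z - r ≠ 0 := sub_ne_zero.mpr (hz r (Multiset.mem_cons_self r s))
    simp only [Multiset.map_cons, Multiset.prod_cons, Multiset.sum_cons]
    generalize (s.map fun r => X - C r).prod = p at *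
    generalize (s.map fun r => cotKernel z r + 1 / 2).sum = a at *
    generalize (s.map fun r => pairWeight z r).sum = b at *
    have hc : (z - r) * (cotKernel z r + 1 / 2) = z := by
      rw [cotKernel]; field_simp; ring
    have hg : pairWeight z r = (cotKernel z r + 1 / 2) - (cotKernel z r + 1 / 2) ^ 2 := by
      rw [pairWeight_eq (sub_ne_zero.mp hr)]; ring
    have e1 : euler ((X - C r) * p) = X * p + (X - C r) * euler p := by
      simp only [euler, derivative_mul, derivative_sub, derivative_X, derivative_C]
      ring
    have e2 : euler (X * p + (X - C r) * euler p) =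
        X * p + 2 * (X * euler p) + (X - C r) * euler (euler p) := by
      simp only [euler, derivative_mul, derivative_sub, derivative_X, derivative_C, derivative_add]
      ring
    rw [e1, e2]
    simp only [eval_add, eval_mul, eval_X, eval_sub, eval_C, eval_ofNat, i1, i2, hg]
    generalize cotKernel z r + 1 / 2 = x at *
    constructor
    · linear_combination -(eval z p) * hc
    · linear_combination (-(eval z p) - 2 * eval z p * a) * hc

/-- Hopping of a particle whose wave function is `x ∏ (x - r)` with `N - 2` further roots `r`: the
wave function is multiplied by a sum of cotangent kernels and weights. -/
theorem sum_pairWeight_mul_eval_prod {N : ℕ} (α : Fin N) (s : Multiset ℂ)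
    (hs : s.card + 2 = N) (hz : ∀ r ∈ s, eta N α ≠ r) :
    ∑ β : Fin N, pairWeight (eta N α) (eta N β) *
        (eta N β * (s.map fun r => eta N β - r).prod) =
      (eta N α * (s.map fun r => eta N α - r).prod) *
        (((N : ℂ) ^ 2 - 1) / 12 - (N : ℂ) ^ 2 / 8 +
          1 / 2 * ((s.map fun r => cotKernel (eta N α) r).sum ^ 2 +
            (s.map fun r => pairWeight (eta N α) r).sum)) := by
  -- The factor `x` counts as one more root, at `0`, where the cotangent kernel is `1 / 2`.
  set p : ℂ[X] := ((0 ::ₘ s).map fun r => X - C r).prod with hp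
  have hev : ∀ x : ℂ, p.eval x = x * (s.map fun r => x - r).prod := by
    intro x
    rw [hp, eval_multiset_prod]
    simp
  have hdeg : p.natDegree ≤ N := by
    rw [hp, natDegree_multiset_prod_X_sub_C_eq_card, Multiset.card_cons]
    omega
  have h1 := sum_pairWeight_mul_eval α hdeg
  obtain ⟨h2, h3⟩ := euler_prod_X_sub_C (0 ::ₘ s) (eta N α) (by
    intro r hr
    rcases Multiset.mem_cons.mp hr with rfl | hr
    · exact eta_ne_zero N α
    · exact hz r hr)
  rw [← hp] at h2 h3
  simp_rw [hev] at h1 h2 h3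
  rw [h1, h2, h3]
  have e1 : cotKernel (eta N α) 0 = 1 / 2 := by
    have := eta_ne_zero N α
    rw [cotKernel]; field_simp; ring
  have e2 : pairWeight (eta N α) 0 = 0 := by simp [pairWeight]
  have e3 : (s.map fun r => cotKernel (eta N α) r + 1 / 2).sum =
      (s.map fun r => cotKernel (eta N α) r).sum + ((N : ℂ) - 2) / 2 := by
    have hc : (N : ℂ) = s.card + 2 := by exact_mod_cast hs.symm
    rw [Multiset.sum_map_add, hc, Multiset.map_const', Multiset.sum_replicate, nsmul_eq_mul]
    ring
  simp only [Multiset.map_cons, Multiset.sum_cons, e1, e2, e3]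
  ring

/-! ### Three-body sums of cotangent kernels -/

/-- The three-body terms in which all particles have the same color are constant, up to terms with
two of the particles at the same site. -/
theorem sum_sq_sum_cotKernel {ι : Type*} [DecidableEq ι] {v : ι → ℂ} (hv : Function.Injective v)
    (S : Finset ι) :
    3 * ∑ a ∈ S, (∑ b ∈ S, cotKernel (v a) (v b)) ^ 2 =
      ((S.card : ℂ) ^ 3 - S.card) / 4 - 3 * ∑ a ∈ S, ∑ b ∈ S, pairWeight (v a) (v b) := by
  have key : ∀ a b c : ι,
      cotKernel (v a) (v b) * cotKernel (v a) (v c) +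
        cotKernel (v b) (v c) * cotKernel (v b) (v a) +
          cotKernel (v c) (v a) * cotKernel (v c) (v b) =
      1 / 4 - (if a = b then pairWeight (v a) (v c) else 0) -
        (if b = c then pairWeight (v b) (v a) else 0) -
        (if a = c then pairWeight (v c) (v b) else 0) -
        (if a = b then if b = c then 1 / 4 else 0 else 0) := by
    intro a b c
    by_cases hab : a = b
    · subst hab
      by_cases hbc : a = c
      · subst hbc; simp
      · have := pairWeight_eq (hv.ne hbc)
        simp [hbc, this, cotKernel_swap (v a) (v c)]
        ring
    · by_cases hbc : b = c
      · subst hbc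
        have := pairWeight_eq (hv.ne (Ne.symm hab))
        simp [hab, this, cotKernel_swap (v b) (v a)]
        ring
      · by_cases hac : a = c
        · subst hac
          have := pairWeight_eq (hv.ne hab)
          simp [hab, hbc, this, cotKernel_swap (v a) (v b)]
          ring
        · have := cotKernel_triple (hv.ne hab) (hv.ne hbc) (hv.ne hac)
          simp only [hab, hbc, hac, if_false]
          linear_combination this
  have h1 : ∑ a ∈ S, ∑ b ∈ S, ∑ c ∈ S, cotKernel (v a) (v b) * cotKernel (v a) (v c) =
      ∑ a ∈ S, (∑ b ∈ S, cotKernel (v a) (v b)) ^ 2 :=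
    Finset.sum_congr rfl fun a _ => by rw [sq, Finset.sum_mul_sum]
  have h2 : ∑ a ∈ S, ∑ b ∈ S, ∑ c ∈ S, cotKernel (v b) (v c) * cotKernel (v b) (v a) =
      ∑ a ∈ S, (∑ b ∈ S, cotKernel (v a) (v b)) ^ 2 := by
    rw [Finset.sum_comm, ← h1]
    refine Finset.sum_congr rfl fun a _ => ?_
    rw [Finset.sum_comm]
  have h3 : ∑ a ∈ S, ∑ b ∈ S, ∑ c ∈ S, cotKernel (v c) (v a) * cotKernel (v c) (v b) =
      ∑ a ∈ S, (∑ b ∈ S, cotKernel (v a) (v b)) ^ 2 := by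
    rw [Finset.sum_congr rfl fun a _ => Finset.sum_comm, Finset.sum_comm]
    exact Finset.sum_congr rfl fun c _ => by rw [sq, Finset.sum_mul_sum]
  have h4 := Finset.sum_congr rfl fun a (_ : a ∈ S) => Finset.sum_congr rfl fun b (_ : b ∈ S) =>
    Finset.sum_congr rfl fun c (_ : c ∈ S) => key a b c
  simp only [Finset.sum_add_distrib, Finset.sum_sub_distrib] at h4
  rw [h1, h2, h3] at h4
  have e1 : ∑ a ∈ S, ∑ b ∈ S, ∑ c ∈ S, (if a = b then pairWeight (v a) (v c) else 0) =
      ∑ a ∈ S, ∑ b ∈ S, pairWeight (v a) (v b) := by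
    refine Finset.sum_congr rfl fun a ha => ?_
    rw [Finset.sum_comm]
    simp [ha]
  have e2 : ∑ a ∈ S, ∑ b ∈ S, ∑ c ∈ S, (if b = c then pairWeight (v b) (v a) else 0) =
      ∑ a ∈ S, ∑ b ∈ S, pairWeight (v a) (v b) := by
    refine Finset.sum_congr rfl fun a _ => Finset.sum_congr rfl fun b hb => ?_
    simp [hb, pairWeight_comm (v a) (v b)]
  have e3 : ∑ a ∈ S, ∑ b ∈ S, ∑ c ∈ S, (if a = c then pairWeight (v c) (v b) else 0) =
      ∑ a ∈ S, ∑ b ∈ S, pairWeight (v a) (v b) := by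
    refine Finset.sum_congr rfl fun a ha => Finset.sum_congr rfl fun b _ => ?_
    simp [ha]
  have e4 : ∑ a ∈ S, ∑ b ∈ S, ∑ c ∈ S, (if a = b then if b = c then (1 / 4 : ℂ) else 0 else 0) =
      S.card / 4 := by
    have : ∀ a ∈ S, ∑ b ∈ S, ∑ c ∈ S,
        (if a = b then if b = c then (1 / 4 : ℂ) else 0 else 0) = 1 / 4 := by
      intro a ha
      rw [Finset.sum_comm]
      simp [ha]
    rw [Finset.sum_congr rfl this, Finset.sum_const, nsmul_eq_mul]
    ring
  rw [e1, e2, e3, e4] at h4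
  simp only [Finset.sum_const, nsmul_eq_mul] at h4
  linear_combination h4

/-- The three-body terms with two particles in `S` and one in `T` are constant, up to terms in which
the two particles in `S` are at the same site. -/
theorem sum_cotKernel_mul_add_sum_sq {ι κ : Type*} [DecidableEq ι] {v : ι → ℂ}
    (hv : Function.Injective v) {u : κ → ℂ} (S : Finset ι) (T : Finset κ)
    (hu : ∀ a ∈ S, ∀ t ∈ T, v a ≠ u t) :
    2 * ∑ a ∈ S, (∑ b ∈ S, cotKernel (v a) (v b)) * (∑ t ∈ T, cotKernel (v a) (u t)) +
      ∑ t ∈ T, (∑ a ∈ S, cotKernel (u t) (v a)) ^ 2 =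
    (S.card : ℂ) ^ 2 * T.card / 4 - ∑ a ∈ S, ∑ t ∈ T, pairWeight (v a) (u t) := by
  have key : ∀ a ∈ S, ∀ b ∈ S, ∀ t ∈ T,
      cotKernel (v a) (v b) * cotKernel (v a) (u t) +
        cotKernel (v b) (v a) * cotKernel (v b) (u t) +
          cotKernel (u t) (v a) * cotKernel (u t) (v b) =
      1 / 4 - (if a = b then pairWeight (v a) (u t) else 0) := by
    intro a ha b hb t ht
    by_cases hab : a = b
    · subst hab
      have := pairWeight_eq (hu a ha t ht)
      simp [this, cotKernel_swap (v a) (u t)]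
      ring
    · have := cotKernel_triple (hv.ne hab) (hu b hb t ht) (hu a ha t ht)
      simp only [hab, if_false]
      linear_combination this
  have h1 : ∑ a ∈ S, ∑ b ∈ S, ∑ t ∈ T, cotKernel (v a) (v b) * cotKernel (v a) (u t) =
      ∑ a ∈ S, (∑ b ∈ S, cotKernel (v a) (v b)) * (∑ t ∈ T, cotKernel (v a) (u t)) :=
    Finset.sum_congr rfl fun a _ => by rw [Finset.sum_mul_sum]
  have h2 : ∑ a ∈ S, ∑ b ∈ S, ∑ t ∈ T, cotKernel (v b) (v a) * cotKernel (v b) (u t) =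
      ∑ a ∈ S, (∑ b ∈ S, cotKernel (v a) (v b)) * (∑ t ∈ T, cotKernel (v a) (u t)) := by
    rw [Finset.sum_comm, h1]
  have h3 : ∑ a ∈ S, ∑ b ∈ S, ∑ t ∈ T, cotKernel (u t) (v a) * cotKernel (u t) (v b) =
      ∑ t ∈ T, (∑ a ∈ S, cotKernel (u t) (v a)) ^ 2 := by
    rw [Finset.sum_congr rfl fun a _ => Finset.sum_comm, Finset.sum_comm]
    exact Finset.sum_congr rfl fun c _ => by rw [sq, Finset.sum_mul_sum]
  have h4 := Finset.sum_congr rfl fun a (ha : a ∈ S) => Finset.sum_congr rfl fun b (hb : b ∈ S) =>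
    Finset.sum_congr rfl fun t (ht : t ∈ T) => key a ha b hb t ht
  simp only [Finset.sum_add_distrib, Finset.sum_sub_distrib] at h4
  rw [h1, h2, h3] at h4
  have e1 : ∑ a ∈ S, ∑ b ∈ S, ∑ t ∈ T, (if a = b then pairWeight (v a) (u t) else 0) =
      ∑ a ∈ S, ∑ t ∈ T, pairWeight (v a) (u t) := by
    refine Finset.sum_congr rfl fun a ha => ?_
    rw [Finset.sum_comm]
    simp [ha]
  rw [e1] at h4
  simp only [Finset.sum_const, nsmul_eq_mul] at h4
  linear_combination h4

/-! ### The Hamiltonian as a sum of color exchanges -/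

theorem spin_apply {N : ℕ} (α : Fin N) (a : Fin 8) (f : State N) (s : Fin N → Color) :
    spin α a f s = 1 / 2 * ∑ τ : Color, gellMann a (s α) τ * f (Function.update s α τ) := by
  simp only [spin, colorFlip, LinearMap.smul_apply, LinearMap.sum_apply, Pi.smul_apply,
    Finset.sum_apply, smul_eq_mul, LinearMap.coe_mk, AddHom.coe_mk]
  rw [Finset.sum_comm]
  simp

/-- The completeness relation of the Gell-Mann matrices. -/
theorem sum_gellMann_mul (σ τ σ' τ' : Color) :
    ∑ a : Fin 8, gellMann a σ τ * gellMann a σ' τ' =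
      2 * (if σ = τ' then if τ = σ' then 1 else 0 else 0) -
        2 / 3 * (if σ = τ then if σ' = τ' then 1 else 0 else 0) := by
  have h3 : ((Real.sqrt 3 : ℂ)⁻¹) * ((Real.sqrt 3 : ℂ)⁻¹) = 1 / 3 := by
    rw [← mul_inv, ← Complex.ofReal_mul, Real.mul_self_sqrt (by norm_num)]
    norm_num
  have h4 : ((Real.sqrt 3 : ℂ)⁻¹) ^ 2 = 1 / 3 := by rw [sq, h3]
  fin_cases σ <;> fin_cases τ <;> fin_cases σ' <;> fin_cases τ' <;>
    simp [gellMann, Fin.sum_univ_succ] <;> ring_nf <;> simp [h4] <;> norm_num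

/-- Two different sites interact through the exchange `P_{αβ}` of their colors:
`J_α · J_β = (P_{αβ} - 1 / 3) / 2`. -/
theorem sum_spin_mul_spin_apply {N : ℕ} {α β : Fin N} (h : α ≠ β) (f : State N)
    (s : Fin N → Color) :
    (∑ a : Fin 8, spin α a * spin β a) f s =
      1 / 2 * f (s ∘ Equiv.swap α β) - 1 / 6 * f s := by
  have e1 : (∑ a : Fin 8, spin α a * spin β a) f s =
      1 / 4 * ∑ τ : Color, ∑ τ' : Color, (∑ a : Fin 8, gellMann a (s α) τ * gellMann a (s β) τ') *
        f (Function.update (Function.update s α τ) β τ') := by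
    simp only [LinearMap.sum_apply, Finset.sum_apply, Module.End.mul_apply, spin_apply,
      Function.update_of_ne h.symm, Finset.mul_sum, Finset.sum_mul]
    rw [Finset.sum_comm]
    refine Finset.sum_congr rfl fun τ _ => ?_
    rw [Finset.sum_comm]
    exact Finset.sum_congr rfl fun τ' _ => Finset.sum_congr rfl fun a _ => by ring
  have e2 : Function.update (Function.update s α (s β)) β (s α) = s ∘ Equiv.swap α β := by
    funext γ
    by_cases h1 : γ = β
    · subst h1; simp
    by_cases h2 : γ = α
    · subst h2; simp [h]
    simp [h1, h2, Equiv.swap_apply_of_ne_of_ne h2 h1]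
  have e3 : Function.update (Function.update s α (s α)) β (s β) = s := by simp
  rw [e1]
  simp only [sum_gellMann_mul, sub_mul, Finset.sum_sub_distrib, ite_mul, zero_mul,
    mul_ite, mul_one, mul_zero]
  have e4 : ∀ F : Color → Color → ℂ, ∑ τ : Color, ∑ τ' : Color,
      (if s α = τ' then if τ = s β then F τ τ' else 0 else 0) = F (s β) (s α) := by
    intro F
    simp
  have e5 : ∀ F : Color → Color → ℂ, ∑ τ : Color, ∑ τ' : Color,
      (if s α = τ then if s β = τ' then F τ τ' else 0 else 0) = F (s α) (s β) := by
    intro F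
    rw [Finset.sum_comm]
    simp
  rw [e4 fun τ τ' => 2 * f (Function.update (Function.update s α τ) β τ'),
    e5 fun τ τ' => 2 / 3 * f (Function.update (Function.update s α τ) β τ'), e2, e3]
  ring

theorem sum_lt_eq_half_sum {N : ℕ} (F : Fin N → Fin N → ℂ) (hs : ∀ α β, F α β = F β α)
    (h0 : ∀ α, F α α = 0) :
    ∑ α : Fin N, ∑ β : Fin N with α < β, F α β = 1 / 2 * ∑ α : Fin N, ∑ β : Fin N, F α β := by
  have h1 : ∑ α : Fin N, ∑ β : Fin N, F α β =
      ∑ α : Fin N, ∑ β : Fin N, ((if α < β then F α β else 0) + (if β < α then F β α else 0)) := by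
    refine Finset.sum_congr rfl fun α _ => Finset.sum_congr rfl fun β _ => ?_
    rcases lt_trichotomy α β with h | h | h
    · simp [h, h.le]
    · simp [h, h0]
    · simp [h, h.le, hs α β]
  simp only [Finset.sum_add_distrib] at h1
  rw [Finset.sum_comm (f := fun α β => if β < α then F β α else 0)] at h1
  simp only [Finset.sum_filter]
  rw [h1]
  ring

/-- The Hamiltonian as a sum over ordered pairs of sites, which counts every pair twice. The terms
with `α = β` vanish because `pairWeight` does. -/
theorem hamiltonian_apply {N : ℕ} (f : State N) (s : Fin N → Color) :
    hamiltonian N f s = (2 * Real.pi / N : ℂ) ^ 2 *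
      (1 / 4 * ∑ α : Fin N, ∑ β : Fin N,
          pairWeight (eta N α) (eta N β) * f (s ∘ Equiv.swap α β) -
        1 / 12 * ∑ α : Fin N, ∑ β : Fin N, pairWeight (eta N α) (eta N β) * f s) := by
  have h1 : hamiltonian N f s = (2 * Real.pi / N : ℂ) ^ 2 * ∑ α : Fin N, ∑ β : Fin N with α < β,
      pairWeight (eta N α) (eta N β) * (1 / 2 * f (s ∘ Equiv.swap α β) - 1 / 6 * f s) := by
    simp only [hamiltonian, LinearMap.smul_apply, LinearMap.sum_apply, Pi.smul_apply,
      Finset.sum_apply (a := s), smul_eq_mul, inv_norm_sq_eq_pairWeight]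
    congr 1
    · push_cast; ring
    · refine Finset.sum_congr rfl fun α _ => Finset.sum_congr rfl fun β hβ => ?_
      rw [← sum_spin_mul_spin_apply (Finset.mem_filter.mp hβ).2.ne f s, LinearMap.sum_apply,
        Finset.sum_apply]
  rw [h1, sum_lt_eq_half_sum (fun α β => pairWeight (eta N α) (eta N β) *
    (1 / 2 * f (s ∘ Equiv.swap α β) - 1 / 6 * f s))
    (fun α β => by rw [pairWeight_comm, Equiv.swap_comm]) (fun α => by simp)]
  simp only [mul_sub, Finset.sum_sub_distrib, Finset.mul_sum]
  congr 1 <;> refine Finset.sum_congr rfl fun α _ => Finset.sum_congr rfl fun β _ => ?_ <;> ring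

/-! ### Amplitudes of the state of a wave function -/

/-- A flip changes the color of its site from `τ` to `σ ≠ τ`, so a repeated site gives `0`. -/
theorem list_prod_colorFlip_apply {N : ℕ} {σ τ : Color} (hστ : σ ≠ τ) (l : List (Fin N))
    (f : State N) (s : Fin N → Color) :
    ((l.map fun α => colorFlip α σ τ).prod f) s =
      if l.Nodup ∧ ∀ α ∈ l, s α = σ then f (fun α => if α ∈ l then τ else s α) else 0 := by
  induction l generalizing s with
  | nil => simp
  | cons α l ih =>
    have e1 : ((List.map (fun α => colorFlip α σ τ) (α :: l)).prod f) s =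
        if s α = σ then ((List.map (fun α => colorFlip α σ τ) l).prod f) (Function.update s α τ)
          else 0 := by
      simp [colorFlip]
    rw [e1, ih]
    have e2 : (∀ β ∈ l, Function.update s α τ β = σ) ↔ α ∉ l ∧ ∀ β ∈ l, s β = σ := by
      constructor
      · intro h
        have hα : α ∉ l := fun hα => hστ (by simpa using (h α hα).symm)
        refine ⟨hα, fun β hβ => ?_⟩
        have := h β hβ
        rwa [Function.update_of_ne (fun h : β = α => hα (h ▸ hβ))] at this
      · rintro ⟨hα, h⟩ β hβ
        rw [Function.update_of_ne (fun h : β = α => hα (h ▸ hβ))]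
        exact h β hβ
    have e3 : (fun β => if β ∈ l then τ else Function.update s α τ β) =
        fun β => if β ∈ α :: l then τ else s β := by
      funext β
      by_cases h : β = α
      · subst h; simp
      · simp [h]
    simp only [e2, e3]
    simp only [List.nodup_cons, List.mem_cons, forall_eq_or_imp]
    split_ifs <;> tauto

/-- The sites of the configuration `s` which have the color `σ`. -/
def colorSites {N : ℕ} (s : Fin N → Color) (σ : Color) : Finset (Fin N) :=
  Finset.univ.filter fun α => s α = σ

@[simp] theorem mem_colorSites {N : ℕ} {s : Fin N → Color} {σ : Color} {α : Fin N} :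
    α ∈ colorSites s σ ↔ s α = σ := by simp [colorSites]

theorem sum_card_colorSites {N : ℕ} (s : Fin N → Color) :
    (colorSites s blue).card + (colorSites s red).card + (colorSites s green).card = N := by
  have h := Finset.card_eq_sum_card_fiberwise (s := (Finset.univ : Finset (Fin N)))
    (t := (Finset.univ : Finset Color)) (f := s) (fun _ _ => Finset.mem_coe.mpr (Finset.mem_univ _))
  rw [Fin.sum_univ_three, Finset.card_univ, Fintype.card_fin] at h
  exact h.symm

/-- There are `m!` ways to label the `m` elements of a set. -/
theorem card_filter_injective {N m : ℕ} {S : Finset (Fin N)} (hS : S.card = m) :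
    (Finset.univ.filter fun z : Fin m → Fin N => Function.Injective z ∧ ∀ i, z i ∈ S).card
      = m ! := by
  have e : {z : Fin m → Fin N // Function.Injective z ∧ ∀ i, z i ∈ S} ≃ (Fin m ↪ S) :=
    { toFun := fun z => ⟨fun i => ⟨z.1 i, z.2.2 i⟩, fun i j h => z.2.1 (Subtype.mk.inj h)⟩
      invFun := fun z => ⟨fun i => z i, fun i j h => z.injective (Subtype.ext h),
        fun i => (z i).2⟩
      left_inv := fun z => rfl
      right_inv := fun z => rfl }
  rw [← Fintype.card_subtype, Fintype.card_congr e, Fintype.card_embedding_eq, Fintype.card_coe,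
    Fintype.card_fin, hS, Nat.descFactorial_self]

theorem image_eq_of_injective {N m : ℕ} {S : Finset (Fin N)} (hS : S.card = m)
    {z : Fin m → Fin N} (hz : Function.Injective z) (hzS : ∀ i, z i ∈ S) :
    Finset.univ.image z = S := by
  refine Finset.eq_of_subset_of_card_le (Finset.image_subset_iff.mpr fun i _ => hzS i) ?_
  rw [Finset.card_image_of_injective _ hz, Finset.card_univ, Fintype.card_fin, hS]

theorem colorFlips_greenState_apply {N M₁ M₂ : ℕ} (z : Fin M₁ → Fin N) (w : Fin M₂ → Fin N)
    (s : Fin N → Color) :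
    ((List.ofFn fun i => colorFlip (z i) blue green).prod *
        (List.ofFn fun k => colorFlip (w k) red green).prod) (greenState N) s =
      if ((colorSites s blue).card = M₁ ∧ (colorSites s red).card = M₂) ∧
        (Function.Injective z ∧ ∀ i, z i ∈ colorSites s blue) ∧
        (Function.Injective w ∧ ∀ k, w k ∈ colorSites s red) then 1 else 0 := by
  have e1 : (List.ofFn fun i => colorFlip (z i) blue green) =
      (List.ofFn z).map fun α => colorFlip α blue green := by
    rw [List.map_ofFn]; rfl
  have e2 : (List.ofFn fun i => colorFlip (w i) red green) =
      (List.ofFn w).map fun α => colorFlip α red green := by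
    rw [List.map_ofFn]; rfl
  rw [e1, e2, Module.End.mul_apply, list_prod_colorFlip_apply (by decide),
    list_prod_colorFlip_apply (by decide), greenState, Pi.single_apply, ← ite_and, ← ite_and]
  refine if_congr ?_ rfl rfl
  simp only [List.nodup_ofFn, List.mem_ofFn', Set.mem_range, mem_colorSites, funext_iff,
    forall_exists_index, forall_apply_eq_imp_iff]
  constructor
  · rintro ⟨⟨⟨hz, hzb⟩, hw, hwr⟩, hg⟩
    have hwr' : ∀ k, s (w k) = red := by
      intro k
      have := hwr k
      split_ifs at this with h
      · exact absurd this (by decide)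
      · exact this
    refine ⟨⟨?_, ?_⟩, ⟨hz, hzb⟩, hw, hwr'⟩
    · rw [← Fintype.card_fin M₁, ← Finset.card_univ, ← Finset.card_image_of_injective _ hz]
      congr 1
      ext α
      simp only [mem_colorSites, Finset.mem_image, Finset.mem_univ, true_and]
      constructor
      · intro hα
        by_contra hne
        have := hg α
        rw [if_neg hne] at this
        split_ifs at this with h
        · obtain ⟨k, rfl⟩ := h
          rw [hwr' k] at hα
          exact absurd hα (by decide)
        · rw [hα] at this
          exact absurd this (by decide)
      · rintro ⟨i, rfl⟩
        exact hzb i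
    · rw [← Fintype.card_fin M₂, ← Finset.card_univ, ← Finset.card_image_of_injective _ hw]
      congr 1
      ext α
      simp only [mem_colorSites, Finset.mem_image, Finset.mem_univ, true_and]
      constructor
      · intro hα
        by_contra hne
        have := hg α
        rw [if_neg hne] at this
        split_ifs at this with h
        · obtain ⟨k, rfl⟩ := h
          rw [hzb k] at hα
          exact absurd hα (by decide)
        · rw [hα] at this
          exact absurd this (by decide)
      · rintro ⟨i, rfl⟩
        exact hwr' i
  · rintro ⟨⟨hB, hR⟩, ⟨hz, hzb⟩, hw, hwr⟩
    have iz := image_eq_of_injective hB hz (fun i => mem_colorSites.mpr (hzb i))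
    have iw := image_eq_of_injective hR hw (fun i => mem_colorSites.mpr (hwr i))
    refine ⟨⟨⟨hz, hzb⟩, hw, fun k => ?_⟩, fun α => ?_⟩
    · rw [if_neg, hwr k]
      rintro ⟨i, hi⟩
      have := hzb i
      rw [hi, hwr k] at this
      exact absurd this (by decide)
    · have hα1 : (∃ i, z i = α) ↔ s α = blue := by
        rw [← mem_colorSites, ← iz]; simp
      have hα2 : (∃ i, w i = α) ↔ s α = red := by
        rw [← mem_colorSites, ← iw]; simp
      simp only [hα1, hα2]
      generalize s α = σ
      fin_cases σ <;> simp

/-- The amplitudes of the state of a wave function which depends only on the sets of positions. -/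
theorem ket_apply {N M₁ M₂ : ℕ}
    {Ψ : (Fin M₁ → ℂ) → (Fin M₂ → ℂ) → ℂ} {F : Finset (Fin N) → Finset (Fin N) → ℂ}
    (hF : ∀ (z : Fin M₁ → Fin N) (w : Fin M₂ → Fin N), Function.Injective z →
      Function.Injective w → Disjoint (Finset.univ.image z) (Finset.univ.image w) →
      Ψ (fun i => eta N (z i)) (fun k => eta N (w k)) =
        F (Finset.univ.image z) (Finset.univ.image w)) (s : Fin N → Color) :
    ket N Ψ s = if (colorSites s blue).card = M₁ ∧ (colorSites s red).card = M₂ then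
      F (colorSites s blue) (colorSites s red) else 0 := by
  have h1 : ket N Ψ s = 1 / ((M₁ ! : ℂ) * (M₂ ! : ℂ)) *
      ∑ z : Fin M₁ → Fin N, ∑ w : Fin M₂ → Fin N,
        Ψ (fun i => eta N (z i)) (fun k => eta N (w k)) *
        if ((colorSites s blue).card = M₁ ∧ (colorSites s red).card = M₂) ∧
        (Function.Injective z ∧ ∀ i, z i ∈ colorSites s blue) ∧
        (Function.Injective w ∧ ∀ k, w k ∈ colorSites s red) then 1 else 0 := by
    simp only [ket, Pi.smul_apply, Finset.sum_apply, smul_eq_mul,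
      colorFlips_greenState_apply]
  rw [h1]
  by_cases hc : (colorSites s blue).card = M₁ ∧ (colorSites s red).card = M₂
  · obtain ⟨hB, hR⟩ := hc
    have hd : Disjoint (colorSites s blue) (colorSites s red) := by
      rw [Finset.disjoint_left]
      intro α h1 h2
      rw [mem_colorSites] at h1 h2
      rw [h1] at h2
      exact absurd h2 (by decide)
    have h2 : ∀ (z : Fin M₁ → Fin N) (w : Fin M₂ → Fin N),
        (Ψ (fun i => eta N (z i)) (fun k => eta N (w k)) *
        if ((colorSites s blue).card = M₁ ∧ (colorSites s red).card = M₂) ∧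
        (Function.Injective z ∧ ∀ i, z i ∈ colorSites s blue) ∧
        (Function.Injective w ∧ ∀ k, w k ∈ colorSites s red) then (1 : ℂ) else 0) =
        F (colorSites s blue) (colorSites s red) *
        ((if Function.Injective z ∧ ∀ i, z i ∈ colorSites s blue then 1 else 0) *
         (if Function.Injective w ∧ ∀ k, w k ∈ colorSites s red then 1 else 0)) := by
      intro z w
      by_cases hz : Function.Injective z ∧ ∀ i, z i ∈ colorSites s blue
      · by_cases hw : Function.Injective w ∧ ∀ k, w k ∈ colorSites s red
        · have iz := image_eq_of_injective hB hz.1 hz.2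
          have iw := image_eq_of_injective hR hw.1 hw.2
          rw [if_pos ⟨⟨hB, hR⟩, hz, hw⟩, if_pos hz, if_pos hw,
            hF z w hz.1 hw.1 (by rw [iz, iw]; exact hd), iz, iw]
          ring
        · rw [if_neg (fun h => hw h.2.2), if_neg hw]
          ring
      · rw [if_neg (fun h => hz h.2.1), if_neg hz]
        ring
    simp only [h2]
    simp only [← Finset.mul_sum]
    rw [← Finset.sum_mul, Finset.sum_boole, Finset.sum_boole, card_filter_injective hB,
      card_filter_injective hR, if_pos ⟨hB, hR⟩]
    have f1 : (M₁ ! : ℂ) ≠ 0 := by exact_mod_cast Nat.factorial_ne_zero _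
    have f2 : (M₂ ! : ℂ) ≠ 0 := by exact_mod_cast Nat.factorial_ne_zero _
    field_simp
  · rw [if_neg hc]
    simp [hc]

/-! ### The wave functions of the coloron -/

/-- The Fourier transform over the sites extracts a coefficient in the position of the coloron. -/
theorem coloron_eq_coeff {N M₁ M₂ n : ℕ} (hM : M₁ < N) (hn : n < N) (z : Fin M₁ → ℂ)
    (w : Fin M₂ → ℂ) :
    coloron N n z w = (∏ i, (X - C (z i))).coeff n * psi0 z w := by
  set p : ℂ[X] := ∏ i, (X - C (z i)) with hp
  have hdeg : p.natDegree < N := by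
    rw [hp, natDegree_finsetProd_X_sub_C_eq_card]
    simpa using hM
  have h1 : ∀ γ : Fin N, ∏ i, (eta N γ - z i) =
      ∑ m ∈ Finset.range N, p.coeff m * eta N γ ^ m := by
    intro γ
    rw [← eval_eq_sum_range' hdeg, hp, eval_prod]
    simp
  have h2 : ∀ m ∈ Finset.range N, ∑ γ : Fin N, ((eta N γ)⁻¹) ^ n * eta N γ ^ m =
      if n = m then (N : ℂ) else 0 := by
    intro m hm
    rw [Finset.mem_range] at hm
    split_ifs with h
    · subst h
      have : ∀ γ : Fin N, ((eta N γ)⁻¹) ^ n * eta N γ ^ n = 1 := fun γ => by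
        rw [← mul_pow, inv_mul_cancel₀ (eta_ne_zero N γ), one_pow]
      simp_rw [this]
      simp
    · rcases lt_or_gt_of_ne h with h' | h'
      · rw [← sum_eta_pow (k := m - n) (N := N) (by omega) (by omega)]
        refine Finset.sum_congr rfl fun γ _ => ?_
        rw [pow_sub₀ _ (eta_ne_zero N γ) h'.le, inv_pow]
        ring
      · rw [← sum_eta_pow (k := m + N - n) (N := N) (by omega) (by omega)]
        refine Finset.sum_congr rfl fun γ _ => ?_
        rw [pow_sub₀ _ (eta_ne_zero N γ) (by omega), inv_pow, pow_add, eta_pow_card]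
        ring
  have hN : (N : ℂ) ≠ 0 := by exact_mod_cast (by omega : N ≠ 0)
  simp only [coloron, localizedColoron, conj_eta, h1, ← mul_assoc]
  rw [← Finset.sum_mul, ← mul_assoc]
  congr 1
  simp only [Finset.mul_sum]
  rw [Finset.sum_comm]
  have h3 : ∀ m ∈ Finset.range N,
      ∑ γ : Fin N, 1 / (N : ℂ) * ((eta N γ)⁻¹ ^ n * (p.coeff m * eta N γ ^ m)) =
      if n = m then p.coeff m else 0 := by
    intro m hm
    have e : ∑ γ : Fin N, 1 / (N : ℂ) * ((eta N γ)⁻¹ ^ n * (p.coeff m * eta N γ ^ m)) =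
        1 / (N : ℂ) * p.coeff m * ∑ γ : Fin N, ((eta N γ)⁻¹) ^ n * eta N γ ^ m := by
      rw [Finset.mul_sum]
      exact Finset.sum_congr rfl fun γ _ => by ring
    rw [e, h2 m hm]
    split_ifs
    · field_simp
    · simp
  rw [Finset.sum_congr rfl h3]
  simp [hn]

theorem coloron_eq_zero {N M₁ M₂ n : ℕ} (hM : M₁ < n) (hn : n < N) (z : Fin M₁ → ℂ)
    (w : Fin M₂ → ℂ) : coloron N n z w = 0 := by
  rw [coloron_eq_coeff (hM.trans hn) hn, coeff_eq_zero_of_natDegree_lt, zero_mul]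
  rw [natDegree_finsetProd_X_sub_C_eq_card]
  simpa using hM

theorem prod_filter_lt_smul {m : ℕ} (c : ℂ) (z : Fin m → ℂ) :
    ∏ i : Fin m, ∏ j : Fin m with i < j, (c * z i - c * z j) ^ 2 =
      c ^ (m * (m - 1)) * ∏ i : Fin m, ∏ j : Fin m with i < j, (z i - z j) ^ 2 := by
  have h1 : c ^ (m * (m - 1)) = ∏ i : Fin m, ∏ j : Fin m with i < j, c ^ 2 := by
    have := Finset.prod_prod_Ioi_mul_eq_prod_prod_off_diag (fun _ _ : Fin m => c)
    simp only [Finset.prod_const, Finset.card_compl, Fintype.card_fin, Finset.card_singleton,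
      Finset.card_univ, ← pow_mul] at this
    rw [mul_comm m, ← this]
    simp only [Finset.prod_const, Finset.filter_lt_eq_Ioi, sq]
  rw [h1, ← Finset.prod_mul_distrib]
  refine Finset.prod_congr rfl fun i _ => ?_
  rw [← Finset.prod_mul_distrib]
  exact Finset.prod_congr rfl fun j _ => by ring

theorem psi0_smul {M₁ M₂ : ℕ} (c : ℂ) (z : Fin M₁ → ℂ) (w : Fin M₂ → ℂ) :
    psi0 (fun i => c * z i) (fun k => c * w k) =
      c ^ (M₁ * (M₁ - 1) + M₂ * (M₂ - 1) + M₁ * M₂ + M₁ + M₂) * psi0 z w := by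
  have h3 : ∏ i : Fin M₁, ∏ k : Fin M₂, (c * z i - c * w k) =
      c ^ (M₁ * M₂) * ∏ i : Fin M₁, ∏ k : Fin M₂, (z i - w k) := by
    simp only [← mul_sub, Finset.prod_mul_distrib, Finset.prod_const, Finset.card_univ,
      Fintype.card_fin, ← pow_mul]
    rw [mul_comm M₁]
  rw [psi0, prod_filter_lt_smul, prod_filter_lt_smul, h3, psi0]
  simp only [Finset.prod_mul_distrib, Finset.prod_const, Finset.card_univ, Fintype.card_fin]
  ring

theorem coeff_prod_X_sub_C_smul {m n : ℕ} (hn : n ≤ m) {c : ℂ} (hc : c ≠ 0) (z : Fin m → ℂ) :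
    (∏ i, (X - C (c * z i))).coeff n = c ^ (m - n) * (∏ i, (X - C (z i))).coeff n := by
  have h1 : (∏ i, (X - C (c * z i))).comp (C c * X) = C (c ^ m) * ∏ i, (X - C (z i)) := by
    have : ∀ i, (X - C (c * z i)).comp (C c * X) = C c * (X - C (z i)) := by
      intro i
      simp [mul_sub]
    rw [Polynomial.prod_comp]
    simp only [this, Finset.prod_mul_distrib, Finset.prod_const, Finset.card_univ,
      Fintype.card_fin, C_pow]
  have h2 := congrArg (fun p => coeff p n) h1
  simp only [comp_C_mul_X_coeff, coeff_C_mul] at h2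
  have h3 : c ^ m = c ^ (m - n) * c ^ n := by rw [← pow_add]; congr 1; omega
  rw [h3] at h2
  exact mul_right_cancel₀ (pow_ne_zero n hc) (by linear_combination h2)

theorem coloron_hasMomentum {N M M₁ M₂ n : ℕ} (hN : N + 1 = 3 * M) (hM₁ : 3 * M₁ + 2 = N)
    (hM₂ : 3 * M₂ = N + 1) (hn : n ≤ M₁) :
    HasMomentum N (coloron N n : (Fin M₁ → ℂ) → (Fin M₂ → ℂ) → ℂ) (coloronMomentum N n) := by
  intro z w
  have hc : eta1 N ≠ 0 := Complex.exp_ne_zero _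
  rw [coloron_eq_coeff (by omega) (by omega), coloron_eq_coeff (by omega) (by omega), psi0_smul,
    coeff_prod_X_sub_C_smul hn hc]
  obtain ⟨k, rfl⟩ := Nat.exists_eq_add_of_le hn
  have h2 : M₂ = n + k + 1 := by omega
  subst h2
  have hN' : (N : ℂ) = 3 * (n + k) + 2 := by exact_mod_cast hM₁.symm
  have h0 : (3 * ((n : ℂ) + k) + 2) ≠ 0 := by
    rw [← hN']
    exact_mod_cast (by omega : N ≠ 0)
  -- the degree of the wave function is `n + 2 k + 1 + (n + k) N`
  have e : eta1 N ^ (n + k - n) * eta1 N ^ ((n + k) * (n + k - 1) +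
      (n + k + 1) * (n + k + 1 - 1) + (n + k) * (n + k + 1) + (n + k) + (n + k + 1)) =
      Complex.exp (Complex.I * (coloronMomentum N n : ℝ)) := by
    rw [← pow_add]
    have hd : n + k - n + ((n + k) * (n + k - 1) +
      (n + k + 1) * (n + k + 1 - 1) + (n + k) * (n + k + 1) + (n + k) + (n + k + 1)) =
        (n + 2 * k + 1) + N * (n + k) := by
      rw [← hM₁]
      rcases Nat.eq_zero_or_pos (n + k) with h | h
      · have : n = 0 := by omega
        have : k = 0 := by omega
        subst_vars; rfl
      · obtain ⟨m, hm⟩ : ∃ m, n + k = m + 1 := ⟨n + k - 1, by omega⟩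
        have : n + 2 * k + 1 = k + (m + 2) := by omega
        rw [this, hm, Nat.add_sub_cancel, Nat.add_sub_cancel,
          show m + 1 - n = k by omega]
        ring
    rw [hd, pow_add, pow_mul, (eta1_isPrimitiveRoot (by omega)).pow_eq_one, one_pow, mul_one,
      eta1, ← Complex.exp_nat_mul]
    congr 1
    simp only [coloronMomentum]
    push_cast
    rw [hN']
    field_simp
    ring
  rw [← e]
  ring

/-! ### Amplitudes as functions of the sets of blue and red sites -/

/-- The difference `η_α - η_β` of two sites, replaced by `1` for `α = β`, so that products over
pairs of sites need not exclude the diagonal. -/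
noncomputable def siteDiff (N : ℕ) (α β : Fin N) : ℂ :=
  if α = β then 1 else eta N α - eta N β

/-- The wave function `Ψ₀` as a function of the set `B` of blue sites and the set `R` of red sites,
up to sign: each squared difference is replaced by the product over both orders of the pair. -/
noncomputable def baseAmplitude (N : ℕ) (B R : Finset (Fin N)) : ℂ :=
  (∏ a ∈ B, ∏ b ∈ B, siteDiff N a b) * (∏ a ∈ R, ∏ b ∈ R, siteDiff N a b) *
    (∏ a ∈ B, ∏ b ∈ R, siteDiff N a b) * (∏ a ∈ B, eta N a) * (∏ a ∈ R, eta N a)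

/-- The sign by which `∏_{i<j} (z_i - z_j)²` and `∏_{i≠j} (z_i - z_j)` differ for `m` particles. -/
noncomputable def pairSign (m : ℕ) : ℂ := ∏ i : Fin m, ∏ _j ∈ Finset.Ioi i, (-1)

theorem pairSign_ne_zero (m : ℕ) : pairSign m ≠ 0 :=
  Finset.prod_ne_zero_iff.mpr fun _ _ => Finset.prod_ne_zero_iff.mpr fun _ _ => by norm_num

theorem siteDiff_ne_zero {N : ℕ} (α β : Fin N) : siteDiff N α β ≠ 0 := by
  rw [siteDiff]
  split_ifs with h
  · exact one_ne_zero
  · exact sub_ne_zero.mpr ((eta_injective N).ne h)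

theorem siteDiff_self {N : ℕ} (α : Fin N) : siteDiff N α α = 1 := if_pos rfl

theorem siteDiff_of_ne {N : ℕ} {α β : Fin N} (h : α ≠ β) :
    siteDiff N α β = eta N α - eta N β := if_neg h

theorem baseAmplitude_ne_zero {N : ℕ} (B R : Finset (Fin N)) : baseAmplitude N B R ≠ 0 := by
  refine mul_ne_zero (mul_ne_zero (mul_ne_zero (mul_ne_zero ?_ ?_) ?_) ?_) ?_ <;>
    refine Finset.prod_ne_zero_iff.mpr fun _ _ => ?_
  · exact Finset.prod_ne_zero_iff.mpr fun _ _ => siteDiff_ne_zero _ _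
  · exact Finset.prod_ne_zero_iff.mpr fun _ _ => siteDiff_ne_zero _ _
  · exact Finset.prod_ne_zero_iff.mpr fun _ _ => siteDiff_ne_zero _ _
  · exact eta_ne_zero N _
  · exact eta_ne_zero N _

theorem prod_filter_lt_sq_eq {N m : ℕ} {z : Fin m → Fin N} (hz : Function.Injective z) :
    ∏ i : Fin m, ∏ j : Fin m with i < j, (eta N (z i) - eta N (z j)) ^ 2 =
      pairSign m * ∏ a ∈ Finset.univ.image z, ∏ b ∈ Finset.univ.image z, siteDiff N a b := by
  have h1 := Finset.prod_prod_Ioi_mul_eq_prod_prod_off_diag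
    (fun j i : Fin m => eta N (z i) - eta N (z j))
  have h2 : ∀ i : Fin m, ∏ j ∈ ({i}ᶜ : Finset (Fin m)), (eta N (z i) - eta N (z j)) =
      ∏ b ∈ Finset.univ.image z, siteDiff N (z i) b := by
    intro i
    rw [Finset.prod_image (fun a _ b _ h => hz h), ← Finset.mul_prod_erase _ _ (Finset.mem_univ i),
      siteDiff_self, one_mul]
    refine Finset.prod_congr (by ext; simp) fun j hj => ?_
    rw [siteDiff_of_ne (hz.ne (Finset.ne_of_mem_erase hj).symm)]
  rw [Finset.prod_image (fun a _ b _ h => hz h), ← Finset.prod_congr rfl fun i _ => h2 i, ← h1,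
    pairSign, ← Finset.prod_mul_distrib]
  refine Finset.prod_congr rfl fun i _ => ?_
  rw [← Finset.prod_mul_distrib, Finset.filter_lt_eq_Ioi]
  exact Finset.prod_congr rfl fun j _ => by ring

theorem psi0_eq_baseAmplitude {N M₁ M₂ : ℕ} {z : Fin M₁ → Fin N} {w : Fin M₂ → Fin N}
    (hz : Function.Injective z) (hw : Function.Injective w)
    (hd : Disjoint (Finset.univ.image z) (Finset.univ.image w)) :
    psi0 (fun i => eta N (z i)) (fun k => eta N (w k)) =
      pairSign M₁ * pairSign M₂ *
        baseAmplitude N (Finset.univ.image z) (Finset.univ.image w) := by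
  have h1 : ∏ i : Fin M₁, ∏ k : Fin M₂, (eta N (z i) - eta N (w k)) =
      ∏ a ∈ Finset.univ.image z, ∏ b ∈ Finset.univ.image w, siteDiff N a b := by
    rw [Finset.prod_image (fun a _ b _ h => hz h)]
    refine Finset.prod_congr rfl fun i _ => ?_
    rw [Finset.prod_image (fun a _ b _ h => hw h)]
    refine Finset.prod_congr rfl fun k _ => (siteDiff_of_ne fun h => ?_).symm
    exact Finset.disjoint_left.mp hd (Finset.mem_image_of_mem z (Finset.mem_univ i))
      (h ▸ Finset.mem_image_of_mem w (Finset.mem_univ k))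
  rw [psi0, prod_filter_lt_sq_eq hz, prod_filter_lt_sq_eq hw, h1, baseAmplitude,
    Finset.prod_image (f := fun a => eta N a) (fun a _ b _ h => hz h),
    Finset.prod_image (f := fun a => eta N a) (fun a _ b _ h => hw h)]
  ring

/-- The amplitudes of the coloron states. -/
theorem ket_coloron_apply {N M₁ M₂ n : ℕ} (hM₁ : M₁ < N) (hn : n < N)
    (s : Fin N → Color) :
    ket N (coloron N n : (Fin M₁ → ℂ) → (Fin M₂ → ℂ) → ℂ) s =
      if (colorSites s blue).card = M₁ ∧ (colorSites s red).card = M₂ then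
        pairSign M₁ * pairSign M₂ * baseAmplitude N (colorSites s blue) (colorSites s red) *
          (∏ b ∈ colorSites s blue, (X - C (eta N b))).coeff n
      else 0 := by
  refine ket_apply (F := fun B R => pairSign M₁ * pairSign M₂ * baseAmplitude N B R *
    (∏ b ∈ B, (X - C (eta N b))).coeff n) (fun z w hz hw hd => ?_) s
  rw [coloron_eq_coeff hM₁ hn, psi0_eq_baseAmplitude hz hw hd,
    Finset.prod_image (fun a _ b _ h => hz h)]
  ring

/-- If a coefficient of `∏_{b ∈ S} (X - η_b)` vanished for all sets `S` of `m` sites, then it would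
vanish for all sets of `m - 1` sites, because `∏_{b ∈ S} (X - η_b)` is a multiple of the difference
of the polynomials of `S ∪ {α}` and `S ∪ {β}`; but the leading coefficient is `1`. -/
theorem exists_coeff_prod_ne_zero {N n m : ℕ} (hnm : n ≤ m) (hm : m < N) :
    ∃ S : Finset (Fin N), S.card = m ∧ (∏ b ∈ S, (X - C (eta N b))).coeff n ≠ 0 := by
  induction m, hnm using Nat.le_induction with
  | base =>
    obtain ⟨S, -, hS⟩ := Finset.exists_subset_card_eq (s := (Finset.univ : Finset (Fin N)))
      (n := n) (by simpa using hm.le)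
    refine ⟨S, hS, ?_⟩
    have h1 : (∏ b ∈ S, (X - C (eta N b))).Monic := monic_prod_X_sub_C _ _
    have h2 := h1.coeff_natDegree
    rw [natDegree_finsetProd_X_sub_C_eq_card, hS] at h2
    rw [h2]
    exact one_ne_zero
  | succ m hnm ih =>
    obtain ⟨S, hS, hne⟩ := ih (by omega)
    have hc : 1 < Sᶜ.card := by rw [Finset.card_compl, Fintype.card_fin]; omega
    obtain ⟨α, hα, β, hβ, hαβ⟩ := Finset.one_lt_card.mp hc
    rw [Finset.mem_compl] at hα hβ
    by_contra! hall
    have e1 := hall (insert α S) (by rw [Finset.card_insert_of_notMem hα, hS])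
    have e2 := hall (insert β S) (by rw [Finset.card_insert_of_notMem hβ, hS])
    rw [Finset.prod_insert hα] at e1
    rw [Finset.prod_insert hβ] at e2
    have e3 : C (eta N β - eta N α) * ∏ b ∈ S, (X - C (eta N b)) =
        (X - C (eta N α)) * ∏ b ∈ S, (X - C (eta N b)) -
          (X - C (eta N β)) * ∏ b ∈ S, (X - C (eta N b)) := by
      rw [C_sub]
      ring
    have e4 := congrArg (fun p => coeff p n) e3
    simp only [coeff_C_mul, coeff_sub, e1, e2, sub_self, mul_eq_zero] at e4
    rcases e4 with h | h
    · exact hαβ (eta_injective N (sub_eq_zero.mp h)).symm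
    · exact hne h

theorem ket_coloron_ne_zero {N M₁ M₂ n : ℕ} (hM : M₁ + M₂ ≤ N) (hM₁ : M₁ < N) (hn : n ≤ M₁) :
    ket N (coloron N n : (Fin M₁ → ℂ) → (Fin M₂ → ℂ) → ℂ) ≠ 0 := by
  obtain ⟨B, hB, hne⟩ := exists_coeff_prod_ne_zero hn hM₁
  obtain ⟨R, hRB, hR⟩ := Finset.exists_subset_card_eq (s := Bᶜ) (n := M₂)
    (by rw [Finset.card_compl, Fintype.card_fin]; omega)
  have hRB' : ∀ α ∈ R, α ∉ B := fun α h => Finset.mem_compl.mp (hRB h)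
  set s : Fin N → Color := fun α => if α ∈ B then blue else if α ∈ R then red else green with hs
  have h1 : colorSites s blue = B := by
    ext α
    simp only [mem_colorSites, hs]
    split_ifs with h h'
    · exact iff_of_true rfl h
    · exact iff_of_false (by decide) h
    · exact iff_of_false (by decide) h
  have h2 : colorSites s red = R := by
    ext α
    simp only [mem_colorSites, hs]
    split_ifs with h h'
    · exact iff_of_false (by decide) fun h' => hRB' α h' h
    · exact iff_of_true rfl h'
    · exact iff_of_false (by decide) h'
  intro h0
  have h3 := congrFun h0 s
  rw [ket_coloron_apply hM₁ (by omega), h1, h2, if_pos ⟨hB, hR⟩] at h3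
  exact mul_ne_zero (mul_ne_zero (mul_ne_zero (pairSign_ne_zero _) (pairSign_ne_zero _))
    (baseAmplitude_ne_zero B R)) hne h3

/-! ### Symmetry between red and green -/

theorem prod_X_sub_C_eta {N : ℕ} (hN : 0 < N) :
    ∏ β : Fin N, (X - C (eta N β)) = (X ^ N - 1 : ℂ[X]) := by
  have hp := eta1_isPrimitiveRoot hN.ne'
  rw [X_pow_sub_one_eq_prod hN hp, ← Finset.prod_image (s := Finset.univ) (g := eta N)
    (f := fun x => X - C x) (fun a _ b _ h => eta_injective N h)]
  refine Finset.prod_congr (Finset.eq_of_subset_of_card_le ?_ ?_) fun _ _ => rfl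
  · refine Finset.image_subset_iff.mpr fun α _ => ?_
    rw [mem_nthRootsFinset hN]
    exact eta_pow_card N α
  · rw [hp.card_nthRootsFinset, Finset.card_image_of_injective _ (eta_injective N)]
    simp

/-- The product is the derivative of `x ^ N - 1` at a root. -/
theorem eta_mul_prod_siteDiff {N : ℕ} (α : Fin N) :
    eta N α * ∏ β : Fin N, siteDiff N α β = N := by
  have hN : 0 < N := by have := α.2; omega
  have h1 := Lagrange.eval_nodal_derivative_eval_node_eq (v := eta N) (Finset.mem_univ α)
  rw [Lagrange.nodal, prod_X_sub_C_eta hN] at h1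
  simp only [derivative_sub, derivative_X_pow, derivative_one, sub_zero, eval_mul, eval_pow,
    eval_X, eval_C] at h1
  rw [← Finset.mul_prod_erase _ _ (Finset.mem_univ α), siteDiff_self, one_mul,
    Finset.prod_congr rfl fun β hβ =>
      siteDiff_of_ne (Finset.ne_of_mem_erase hβ).symm, ← Lagrange.eval_nodal]
  rw [← h1]
  have h2 : eta N α ^ (N - 1) * eta N α = 1 := by
    rw [← pow_succ, Nat.sub_add_cancel hN, eta_pow_card]
  linear_combination (N : ℂ) * h2

theorem prod_siteDiff_swap {N : ℕ} {S T : Finset (Fin N)} (h : Disjoint S T) :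
    ∏ a ∈ T, ∏ b ∈ S, siteDiff N a b =
      (-1) ^ (S.card * T.card) * ∏ a ∈ S, ∏ b ∈ T, siteDiff N a b := by
  rw [Finset.prod_comm, mul_comm S.card, pow_mul, ← Finset.prod_const, ← Finset.prod_mul_distrib]
  refine Finset.prod_congr rfl fun a ha => ?_
  rw [← Finset.prod_const, ← Finset.prod_mul_distrib]
  refine Finset.prod_congr rfl fun b hb => ?_
  have hab : a ≠ b := fun h' => Finset.disjoint_left.mp h ha (h' ▸ hb)
  rw [siteDiff_of_ne hab, siteDiff_of_ne hab.symm]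
  ring

/-- The differences of a red site to all other sites multiply to `N / η_a`, so the red particles can
be traded for the green ones. The sign depends on the number of particles only. -/
theorem baseAmplitude_red_eq_green {N m : ℕ} {B R G : Finset (Fin N)} (hBR : Disjoint B R)
    (hBG : Disjoint B G) (hRG : Disjoint R G) (hU : B ∪ R ∪ G = Finset.univ) (hR : R.card = m)
    (hG : G.card = m) : baseAmplitude N B R = (-1) ^ (m * m) * baseAmplitude N B G := by
  have hrow : ∀ a : Fin N, ∏ b : Fin N, siteDiff N a b =
      (∏ b ∈ B, siteDiff N a b) * (∏ b ∈ R, siteDiff N a b) * ∏ b ∈ G, siteDiff N a b := by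
    intro a
    rw [← hU, Finset.prod_union (Finset.disjoint_union_left.mpr ⟨hBG, hRG⟩),
      Finset.prod_union hBR]
  have hS : ∀ S : Finset (Fin N), (∏ a ∈ S, eta N a) * ((∏ a ∈ S, ∏ b ∈ B, siteDiff N a b) *
      (∏ a ∈ S, ∏ b ∈ R, siteDiff N a b) * ∏ a ∈ S, ∏ b ∈ G, siteDiff N a b) =
      (N : ℂ) ^ S.card := by
    intro S
    rw [← Finset.prod_mul_distrib, ← Finset.prod_mul_distrib, ← Finset.prod_mul_distrib,
      ← Finset.prod_const]
    refine Finset.prod_congr rfl fun a _ => ?_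
    rw [← hrow, eta_mul_prod_siteDiff]
  have h1 := hS R
  have h2 := hS G
  rw [prod_siteDiff_swap hBR, hR] at h1
  rw [prod_siteDiff_swap hBG, prod_siteDiff_swap hRG, hG, hR] at h2
  have hne : (-1 : ℂ) ^ (B.card * m) * ∏ a ∈ R, ∏ b ∈ G, siteDiff N a b ≠ 0 :=
    mul_ne_zero (pow_ne_zero _ (by norm_num))
      (Finset.prod_ne_zero_iff.mpr fun _ _ => Finset.prod_ne_zero_iff.mpr fun _ _ =>
        siteDiff_ne_zero _ _)
  refine mul_right_cancel₀ hne ?_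
  simp only [baseAmplitude]
  linear_combination ((∏ a ∈ B, ∏ b ∈ B, siteDiff N a b) * ∏ a ∈ B, eta N a) * (h1 - h2)

/-! ### Hopping amplitudes -/

/-- A particle of color `S` hops from the site `α` to the sites outside of `S ∪ T`, where `T` is the
set of sites of another color. Its wave function has double zeros at the other particles of `S`,
simple zeros at `T`, and further zeros `E`. -/
theorem sum_pairWeight_mul_hop {N : ℕ} {S T : Finset (Fin N)} {α : Fin N} (hα : α ∈ S)
    (hST : Disjoint S T) (E : Multiset ℂ) (hE : ∀ r ∈ E, eta N α ≠ r)
    (hcard : E.card + 2 * S.card + T.card = N) (A : Fin N → ℂ) (c : ℂ)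
    (hA : ∀ β, β ∉ S.erase α → β ∉ T → A β = c * (eta N β * (E.map fun r => eta N β - r).prod *
      (∏ b ∈ S.erase α, (eta N β - eta N b)) ^ 2 * ∏ t ∈ T, (eta N β - eta N t))) :
    ∑ β ∈ (S ∪ T)ᶜ, pairWeight (eta N α) (eta N β) * A β =
      A α * (((N : ℂ) ^ 2 - 1) / 12 - (N : ℂ) ^ 2 / 8 +
        1 / 2 * (((E.map fun r => cotKernel (eta N α) r).sum +
            2 * ∑ b ∈ S, cotKernel (eta N α) (eta N b) +
            ∑ t ∈ T, cotKernel (eta N α) (eta N t)) ^ 2 +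
          ((E.map fun r => pairWeight (eta N α) r).sum +
            2 * ∑ b ∈ S, pairWeight (eta N α) (eta N b) +
            ∑ t ∈ T, pairWeight (eta N α) (eta N t)))) := by
  set s : Multiset ℂ :=
    E + (2 • (S.erase α).val.map (eta N) + T.val.map (eta N)) with hs
  have hαT : α ∉ T := Finset.disjoint_left.mp hST hα
  have hprod : ∀ x : ℂ, (s.map fun r => x - r).prod = (E.map fun r => x - r).prod *
      ((∏ b ∈ S.erase α, (x - eta N b)) ^ 2 * ∏ t ∈ T, (x - eta N t)) := by
    intro x
    simp only [hs, Multiset.map_add, Multiset.prod_add, Multiset.map_nsmul, Multiset.prod_nsmul,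
      Multiset.map_map]
    rfl
  have hsum : ∀ f : ℂ → ℂ, f (eta N α) = 0 → (s.map f).sum = (E.map f).sum +
      2 * ∑ b ∈ S, f (eta N b) + ∑ t ∈ T, f (eta N t) := by
    intro f hf
    rw [← Finset.sum_erase S (f := fun b => f (eta N b)) hf]
    simp only [hs, Multiset.map_add, Multiset.sum_add, Multiset.map_nsmul, Multiset.sum_nsmul,
      Multiset.map_map, nsmul_eq_mul, Nat.cast_ofNat, add_assoc]
    rfl
  have hscard : s.card + 2 = N := by
    have := Finset.card_erase_add_one hα
    simp only [hs, Multiset.card_add, Multiset.card_nsmul, Multiset.card_map, Finset.card_val]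
    omega
  have hz : ∀ r ∈ s, eta N α ≠ r := by
    intro r hr
    simp only [hs, Multiset.mem_add, Multiset.mem_nsmul_of_ne_zero (two_ne_zero),
      Multiset.mem_map, Finset.mem_val] at hr
    rcases hr with hr | ⟨b, hb, rfl⟩ | ⟨t, ht, rfl⟩
    · exact hE r hr
    · exact (eta_injective N).ne (Finset.ne_of_mem_erase hb).symm
    · exact (eta_injective N).ne fun h => hαT (h ▸ ht)
  have hmain := sum_pairWeight_mul_eval_prod α s hscard hz
  rw [hsum _ (cotKernel_self _), hsum _ (pairWeight_self _)] at hmain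
  have hAα := hA α (Finset.notMem_erase α S) hαT
  -- The zeros of the wave function at the occupied sites extend the sum to all sites.
  have hL : ∑ β ∈ (S ∪ T)ᶜ, pairWeight (eta N α) (eta N β) * A β =
      c * ∑ β : Fin N, pairWeight (eta N α) (eta N β) *
        (eta N β * (s.map fun r => eta N β - r).prod) := by
    rw [Finset.mul_sum]
    refine Finset.sum_subset_zero_on_sdiff (Finset.subset_univ _) ?_ ?_
    · intro β hβ
      simp only [Finset.mem_sdiff, Finset.mem_univ, true_and, Finset.mem_compl, not_not,
        Finset.mem_union] at hβ
      by_cases h : α = β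
      · simp [h]
      rcases hβ with hβ | hβ
      · have : ∏ b ∈ S.erase α, (eta N β - eta N b) = 0 :=
          Finset.prod_eq_zero (Finset.mem_erase.mpr ⟨Ne.symm h, hβ⟩) (sub_self _)
        rw [hprod, this]
        ring
      · have : ∏ t ∈ T, (eta N β - eta N t) = 0 := Finset.prod_eq_zero hβ (sub_self _)
        rw [hprod, this]
        ring
    · intro β hβ
      simp only [Finset.mem_compl, Finset.mem_union, not_or] at hβ
      rw [hA β (fun h => hβ.1 (Finset.mem_of_mem_erase h)) hβ.2, hprod]
      ring
  rw [hL, hmain, hAα, hprod]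
  ring

theorem prod_siteDiff_insert {N : ℕ} {S : Finset (Fin N)} {β : Fin N} (hβ : β ∉ S) :
    ∏ a ∈ insert β S, ∏ b ∈ insert β S, siteDiff N a b =
      (-1) ^ S.card * (∏ b ∈ S, (eta N β - eta N b)) ^ 2 *
        ∏ a ∈ S, ∏ b ∈ S, siteDiff N a b := by
  have h1 : ∏ b ∈ S, siteDiff N β b = ∏ b ∈ S, (eta N β - eta N b) :=
    Finset.prod_congr rfl fun b hb => siteDiff_of_ne fun h => hβ (h ▸ hb)
  have h2 : ∏ b ∈ S, siteDiff N b β = (-1) ^ S.card * ∏ b ∈ S, (eta N β - eta N b) := by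
    rw [← Finset.prod_const, ← Finset.prod_mul_distrib]
    refine Finset.prod_congr rfl fun b hb => ?_
    rw [siteDiff_of_ne fun h : b = β => hβ (h ▸ hb)]
    ring
  rw [Finset.prod_insert hβ, Finset.prod_insert hβ, siteDiff_self,
    Finset.prod_congr rfl fun a _ => Finset.prod_insert hβ, Finset.prod_mul_distrib, h1, h2]
  ring

/-- The amplitude of a coloron at the position `x`, as a function of the sets of blue and red
sites. -/
noncomputable def colorAmplitude (N : ℕ) (x : ℂ) (B R : Finset (Fin N)) : ℂ :=
  baseAmplitude N B R * ∏ b ∈ B, (x - eta N b)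

/-- Hopping of a blue particle to the green sites. -/
theorem sum_pairWeight_mul_hop_blue {N : ℕ} {x : ℂ} (hx : ∀ α, eta N α ≠ x)
    {B R : Finset (Fin N)} (hBR : Disjoint B R) (hcard : 2 * B.card + R.card + 1 = N)
    {α : Fin N} (hα : α ∈ B) :
    ∑ β ∈ (B ∪ R)ᶜ, pairWeight (eta N α) (eta N β) *
        colorAmplitude N x (insert β (B.erase α)) R =
      colorAmplitude N x B R * (((N : ℂ) ^ 2 - 1) / 12 - (N : ℂ) ^ 2 / 8 +
        1 / 2 * ((cotKernel (eta N α) x +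
            2 * ∑ b ∈ B, cotKernel (eta N α) (eta N b) +
            ∑ t ∈ R, cotKernel (eta N α) (eta N t)) ^ 2 +
          (pairWeight (eta N α) x +
            2 * ∑ b ∈ B, pairWeight (eta N α) (eta N b) +
            ∑ t ∈ R, pairWeight (eta N α) (eta N t)))) := by
  -- The constant factor is, up to sign, the amplitude with the particle at `α` removed.
  have h := sum_pairWeight_mul_hop hα hBR {x} (by simpa using hx α)
    (by rw [Multiset.card_singleton]; omega)
    (fun β => colorAmplitude N x (insert β (B.erase α)) R)
    (-((-1) ^ (B.erase α).card * baseAmplitude N (B.erase α) R *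
      ∏ b ∈ B.erase α, (x - eta N b))) (by
    intro β hβ hβR
    have h1 : ∏ t ∈ R, siteDiff N β t = ∏ t ∈ R, (eta N β - eta N t) :=
      Finset.prod_congr rfl fun b hb => siteDiff_of_ne fun h => hβR (h ▸ hb)
    simp only [colorAmplitude, baseAmplitude]
    rw [prod_siteDiff_insert hβ]
    simp only [Finset.prod_insert hβ, h1,
      Multiset.map_singleton, Multiset.prod_singleton]
    ring)
  simpa only [Finset.insert_erase hα, Multiset.map_singleton, Multiset.sum_singleton] using h

/-- Hopping of a red particle to the green sites. -/
theorem sum_pairWeight_mul_hop_red {N : ℕ} (x : ℂ)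
    {B R : Finset (Fin N)} (hBR : Disjoint B R) (hcard : 2 * R.card + B.card = N)
    {α : Fin N} (hα : α ∈ R) :
    ∑ β ∈ (B ∪ R)ᶜ, pairWeight (eta N α) (eta N β) *
        colorAmplitude N x B (insert β (R.erase α)) =
      colorAmplitude N x B R * (((N : ℂ) ^ 2 - 1) / 12 - (N : ℂ) ^ 2 / 8 +
        1 / 2 * ((2 * ∑ b ∈ R, cotKernel (eta N α) (eta N b) +
            ∑ t ∈ B, cotKernel (eta N α) (eta N t)) ^ 2 +
          (2 * ∑ b ∈ R, pairWeight (eta N α) (eta N b) +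
            ∑ t ∈ B, pairWeight (eta N α) (eta N t)))) := by
  have h := sum_pairWeight_mul_hop hα hBR.symm 0 (by simp)
    (by rw [Multiset.card_zero]; omega)
    (fun β => colorAmplitude N x B (insert β (R.erase α)))
    ((-1) ^ (R.erase α).card * (-1) ^ B.card * baseAmplitude N B (R.erase α) *
      ∏ b ∈ B, (x - eta N b)) (by
    intro β hβ hβB
    have h1 : ∏ b ∈ B, siteDiff N b β = (-1) ^ B.card * ∏ b ∈ B, (eta N β - eta N b) := by
      rw [← Finset.prod_const, ← Finset.prod_mul_distrib]
      refine Finset.prod_congr rfl fun b hb => ?_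
      rw [siteDiff_of_ne fun h : b = β => hβB (h ▸ hb)]
      ring
    simp only [colorAmplitude, baseAmplitude]
    rw [prod_siteDiff_insert hβ]
    simp only [Finset.prod_insert hβ,
      Finset.prod_mul_distrib, h1, Multiset.map_zero, Multiset.prod_zero]
    ring)
  rw [Finset.union_comm B R]
  simpa only [Finset.insert_erase hα, Multiset.map_zero, Multiset.sum_zero, zero_add] using h

/-- Exchange of a blue particle with the red ones. Written in terms of the green particles, this is
hopping of a blue particle to the empty sites. -/
theorem sum_pairWeight_mul_exchange {N m : ℕ} {x : ℂ} (hx : ∀ α, eta N α ≠ x)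
    {B R G : Finset (Fin N)} (hBR : Disjoint B R) (hBG : Disjoint B G) (hRG : Disjoint R G)
    (hU : B ∪ R ∪ G = Finset.univ) (hR : R.card = m) (hG : G.card = m)
    (hcard : 2 * B.card + m + 1 = N) {α : Fin N} (hα : α ∈ B) :
    ∑ β ∈ R, pairWeight (eta N α) (eta N β) *
        colorAmplitude N x (insert β (B.erase α)) (insert α (R.erase β)) =
      colorAmplitude N x B R * (((N : ℂ) ^ 2 - 1) / 12 - (N : ℂ) ^ 2 / 8 +
        1 / 2 * ((cotKernel (eta N α) x +
            2 * ∑ b ∈ B, cotKernel (eta N α) (eta N b) +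
            ∑ t ∈ G, cotKernel (eta N α) (eta N t)) ^ 2 +
          (pairWeight (eta N α) x +
            2 * ∑ b ∈ B, pairWeight (eta N α) (eta N b) +
            ∑ t ∈ G, pairWeight (eta N α) (eta N t)))) := by
  have h := sum_pairWeight_mul_hop_blue hx hBG (by rw [hG]; exact hcard) hα
  have hc : (B ∪ G)ᶜ = R := by
    ext β
    have h1 := Finset.ext_iff.mp hU β
    simp only [Finset.mem_union, Finset.mem_univ, iff_true] at h1
    have h2 : β ∈ R → β ∉ B := fun h h' => Finset.disjoint_left.mp hBR h' h
    have h3 : β ∈ R → β ∉ G := fun h h' => Finset.disjoint_left.mp hRG h h'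
    simp only [Finset.mem_compl, Finset.mem_union]
    tauto
  have h0 : colorAmplitude N x B R = (-1) ^ (m * m) * colorAmplitude N x B G := by
    rw [colorAmplitude, baseAmplitude_red_eq_green hBR hBG hRG hU hR hG, colorAmplitude]
    ring
  rw [h0, mul_assoc, ← h, hc, Finset.mul_sum]
  refine Finset.sum_congr rfl fun β hβ => ?_
  have hαR : α ∉ R := Finset.disjoint_left.mp hBR hα
  have hαG : α ∉ G := Finset.disjoint_left.mp hBG hα
  have hβG : β ∉ G := Finset.disjoint_left.mp hRG hβ
  have hβB : β ∉ B := fun h => Finset.disjoint_left.mp hBR h hβ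
  have hαβ : α ≠ β := fun h => hαR (h ▸ hβ)
  have e : baseAmplitude N (insert β (B.erase α)) (insert α (R.erase β)) =
      (-1) ^ (m * m) * baseAmplitude N (insert β (B.erase α)) G := by
    refine baseAmplitude_red_eq_green ?_ ?_ ?_ ?_ ?_ hG
    · rw [Finset.disjoint_left]
      intro γ h1 h2
      have : γ ∈ B → γ ∉ R := fun h => Finset.disjoint_left.mp hBR h
      simp only [Finset.mem_insert, Finset.mem_erase] at h1 h2
      rcases h1 with rfl | h1 <;> rcases h2 with rfl | h2 <;> tauto
    · rw [Finset.disjoint_left]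
      intro γ h1 h2
      have : γ ∈ B → γ ∉ G := fun h => Finset.disjoint_left.mp hBG h
      simp only [Finset.mem_insert, Finset.mem_erase] at h1
      rcases h1 with rfl | h1 <;> tauto
    · rw [Finset.disjoint_left]
      intro γ h1 h2
      have : γ ∈ R → γ ∉ G := fun h => Finset.disjoint_left.mp hRG h
      simp only [Finset.mem_insert, Finset.mem_erase] at h1
      rcases h1 with rfl | h1 <;> tauto
    · ext γ
      have h1 := Finset.ext_iff.mp hU γ
      simp only [Finset.mem_union, Finset.mem_univ, iff_true] at h1
      simp only [Finset.mem_union, Finset.mem_univ, iff_true, Finset.mem_insert, Finset.mem_erase]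
      tauto
    · rw [Finset.card_insert_of_notMem (fun h => hαR (Finset.mem_of_mem_erase h)),
        Finset.card_erase_add_one hβ, hR]
  rw [colorAmplitude, colorAmplitude, e]
  ring

/-! ### The energy of a coloron -/

/-- The eigenvalue of half of the sum of all weighted color exchanges for `m` blue, `m + 1` red and
`m + 1` green particles, apart from the part which depends on the state of the coloron. -/
noncomputable def exchangeConstant (N m : ℂ) : ℂ :=
  (3 * m + 1) * ((N ^ 2 - 1) / 12 - N ^ 2 / 8) + 5 / 24 * (m ^ 3 - m) + m ^ 2 * (m + 1) / 8 +
    m * (m + 1) ^ 2 / 4 + ((m + 1) ^ 3 - (m + 1)) / 6 + m / 4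

/-- In the sum of the hopping terms of all pairs of colors, the three-body terms combine into
constants and the two-body terms cancel, except for those with the position `x` of the coloron. -/
theorem sum_hop_eq {N m : ℕ} {x : ℂ} (hx : ∀ α, eta N α ≠ x)
    {B R G : Finset (Fin N)} (hBR : Disjoint B R) (hBG : Disjoint B G) (hRG : Disjoint R G)
    (hU : B ∪ R ∪ G = Finset.univ) (hB : B.card = m) (hR : R.card = m + 1) (hG : G.card = m + 1)
    (K : ℂ) (hK : K = ((N : ℂ) ^ 2 - 1) / 12 - (N : ℂ) ^ 2 / 8) :
    ∑ α ∈ B, (K + 1 / 2 * ((cotKernel (eta N α) x +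
            2 * ∑ b ∈ B, cotKernel (eta N α) (eta N b) +
            ∑ t ∈ R, cotKernel (eta N α) (eta N t)) ^ 2 +
          (pairWeight (eta N α) x +
            2 * ∑ b ∈ B, pairWeight (eta N α) (eta N b) +
            ∑ t ∈ R, pairWeight (eta N α) (eta N t)))) +
      ∑ α ∈ B, (K + 1 / 2 * ((cotKernel (eta N α) x +
            2 * ∑ b ∈ B, cotKernel (eta N α) (eta N b) +
            ∑ t ∈ G, cotKernel (eta N α) (eta N t)) ^ 2 +
          (pairWeight (eta N α) x +
            2 * ∑ b ∈ B, pairWeight (eta N α) (eta N b) +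
            ∑ t ∈ G, pairWeight (eta N α) (eta N t)))) +
      ∑ α ∈ R, (K + 1 / 2 * ((2 * ∑ b ∈ R, cotKernel (eta N α) (eta N b) +
            ∑ t ∈ B, cotKernel (eta N α) (eta N t)) ^ 2 +
          (2 * ∑ b ∈ R, pairWeight (eta N α) (eta N b) +
            ∑ t ∈ B, pairWeight (eta N α) (eta N t)))) +
      1 / 2 * (∑ α ∈ B, ∑ β ∈ B, pairWeight (eta N α) (eta N β) +
        ∑ α ∈ R, ∑ β ∈ R, pairWeight (eta N α) (eta N β) +
        ∑ α ∈ G, ∑ β ∈ G, pairWeight (eta N α) (eta N β)) =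
    exchangeConstant N m + 3 / 2 * ((m : ℂ) ^ 2 / 4 - ∑ α ∈ B, pairWeight (eta N α) x -
      (∑ α ∈ B, cotKernel (eta N α) x) ^ 2) := by
  have hsplit : ∀ f : Fin N → ℂ, ∑ β : Fin N, f β = ∑ β ∈ B, f β + ∑ β ∈ R, f β + ∑ β ∈ G, f β := by
    intro f
    rw [← hU, Finset.sum_union (Finset.disjoint_union_left.mpr ⟨hBG, hRG⟩), Finset.sum_union hBR]
  have hne : ∀ {S T : Finset (Fin N)}, Disjoint S T → ∀ a ∈ S, ∀ t ∈ T, eta N a ≠ eta N t :=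
    fun h a ha t ht => (eta_injective N).ne fun e => Finset.disjoint_left.mp h ha (e ▸ ht)
  have hcomm : ∀ S T : Finset (Fin N), ∑ α ∈ S, ∑ β ∈ T, pairWeight (eta N α) (eta N β) =
      ∑ α ∈ T, ∑ β ∈ S, pairWeight (eta N α) (eta N β) := by
    intro S T
    rw [Finset.sum_comm]
    exact Finset.sum_congr rfl fun a _ => Finset.sum_congr rfl fun b _ => pairWeight_comm _ _
  have i1 := sum_sq_sum_cotKernel (eta_injective N) B
  have i2 := sum_cotKernel_mul_add_sum_sq (eta_injective N) B R (hne hBR)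
  have i3 := sum_cotKernel_mul_add_sum_sq (eta_injective N) R B (hne hBR.symm)
  have i4 := sum_sq_sum_cotKernel (eta_injective N) R
  have i5 := sum_cotKernel_mul_add_sum_sq (eta_injective N) (u := fun t : ℂ => t) B {x}
    (fun a _ t ht => by rw [Finset.mem_singleton.mp ht]; exact hx a)
  simp only [Finset.sum_singleton, Finset.card_singleton, Nat.cast_one, mul_one] at i5
  have i6 : ∑ α ∈ B, cotKernel x (eta N α) = -∑ α ∈ B, cotKernel (eta N α) x := by
    rw [← Finset.sum_neg_distrib]
    exact Finset.sum_congr rfl fun a _ => cotKernel_swap _ _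
  rw [i6] at i5
  -- Red and green sites are equal in number, so the weights of their rows have the same sum.
  have rowR : ∑ α ∈ R, ∑ β ∈ B, pairWeight (eta N α) (eta N β) +
      ∑ α ∈ R, ∑ β ∈ R, pairWeight (eta N α) (eta N β) +
      ∑ α ∈ R, ∑ β ∈ G, pairWeight (eta N α) (eta N β) =
      (m + 1) * (((N : ℂ) ^ 2 - 1) / 12) := by
    rw [← Finset.sum_add_distrib, ← Finset.sum_add_distrib, Finset.sum_congr rfl fun α _ =>
      ((hsplit _).symm.trans (sum_pairWeight α)), Finset.sum_const, hR, nsmul_eq_mul]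
    push_cast
    ring
  have rowG : ∑ α ∈ G, ∑ β ∈ B, pairWeight (eta N α) (eta N β) +
      ∑ α ∈ G, ∑ β ∈ R, pairWeight (eta N α) (eta N β) +
      ∑ α ∈ G, ∑ β ∈ G, pairWeight (eta N α) (eta N β) =
      (m + 1) * (((N : ℂ) ^ 2 - 1) / 12) := by
    rw [← Finset.sum_add_distrib, ← Finset.sum_add_distrib, Finset.sum_congr rfl fun α _ =>
      ((hsplit _).symm.trans (sum_pairWeight α)), Finset.sum_const, hG, nsmul_eq_mul]
    push_cast
    ring
  rw [hcomm G R, hcomm G B] at rowG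
  rw [hcomm R B] at i3 rowR
  have hβ : ∀ α, ∑ t ∈ G, cotKernel (eta N α) (eta N t) =
      -∑ b ∈ B, cotKernel (eta N α) (eta N b) - ∑ t ∈ R, cotKernel (eta N α) (eta N t) := by
    intro α
    have h := sum_cotKernel α
    rw [hsplit] at h
    linear_combination h
  -- The kernels at `α` with all sites add up to `0`, which eliminates the green sites.
  have eB : ∑ α ∈ B, (K + 1 / 2 * ((cotKernel (eta N α) x +
            2 * ∑ b ∈ B, cotKernel (eta N α) (eta N b) +
            ∑ t ∈ R, cotKernel (eta N α) (eta N t)) ^ 2 +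
          (pairWeight (eta N α) x +
            2 * ∑ b ∈ B, pairWeight (eta N α) (eta N b) +
            ∑ t ∈ R, pairWeight (eta N α) (eta N t)))) +
      ∑ α ∈ B, (K + 1 / 2 * ((cotKernel (eta N α) x +
            2 * ∑ b ∈ B, cotKernel (eta N α) (eta N b) +
            ∑ t ∈ G, cotKernel (eta N α) (eta N t)) ^ 2 +
          (pairWeight (eta N α) x +
            2 * ∑ b ∈ B, pairWeight (eta N α) (eta N b) +
            ∑ t ∈ G, pairWeight (eta N α) (eta N t)))) =
      m * (2 * K + 1 / 4) +
        5 / 2 * ∑ α ∈ B, (∑ b ∈ B, cotKernel (eta N α) (eta N b)) ^ 2 +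
        ∑ α ∈ B, (∑ b ∈ B, cotKernel (eta N α) (eta N b)) *
          (∑ t ∈ R, cotKernel (eta N α) (eta N t)) +
        ∑ α ∈ B, (∑ t ∈ R, cotKernel (eta N α) (eta N t)) ^ 2 +
        3 * ∑ α ∈ B, (∑ b ∈ B, cotKernel (eta N α) (eta N b)) * cotKernel (eta N α) x +
        2 * ∑ α ∈ B, ∑ b ∈ B, pairWeight (eta N α) (eta N b) +
        1 / 2 * ∑ α ∈ B, ∑ b ∈ R, pairWeight (eta N α) (eta N b) +
        1 / 2 * ∑ α ∈ B, ∑ b ∈ G, pairWeight (eta N α) (eta N b) := by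
    rw [← hB, ← nsmul_eq_mul, ← Finset.sum_const]
    simp only [Finset.mul_sum (s := B), ← Finset.sum_add_distrib]
    refine Finset.sum_congr rfl fun α _ => ?_
    simp only [← Finset.mul_sum]
    rw [hβ, pairWeight_eq (hx α)]
    ring
  have eR : ∑ α ∈ R, (K + 1 / 2 * ((2 * ∑ b ∈ R, cotKernel (eta N α) (eta N b) +
            ∑ t ∈ B, cotKernel (eta N α) (eta N t)) ^ 2 +
          (2 * ∑ b ∈ R, pairWeight (eta N α) (eta N b) +
            ∑ t ∈ B, pairWeight (eta N α) (eta N t)))) =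
      (m + 1) * K +
        2 * ∑ α ∈ R, (∑ b ∈ R, cotKernel (eta N α) (eta N b)) ^ 2 +
        2 * ∑ α ∈ R, (∑ b ∈ R, cotKernel (eta N α) (eta N b)) *
          (∑ t ∈ B, cotKernel (eta N α) (eta N t)) +
        1 / 2 * ∑ α ∈ R, (∑ t ∈ B, cotKernel (eta N α) (eta N t)) ^ 2 +
        ∑ α ∈ R, ∑ b ∈ R, pairWeight (eta N α) (eta N b) +
        1 / 2 * ∑ α ∈ R, ∑ b ∈ B, pairWeight (eta N α) (eta N b) := by
    have hm : ((m : ℂ) + 1) = (R.card : ℂ) := by rw [hR]; push_cast; rfl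
    rw [hm, ← nsmul_eq_mul, ← Finset.sum_const]
    simp only [Finset.mul_sum (s := R), ← Finset.sum_add_distrib]
    refine Finset.sum_congr rfl fun α _ => ?_
    simp only [← Finset.mul_sum]
    ring
  rw [eB, eR, hcomm R B]
  rw [hB] at i1 i2 i3 i5
  rw [hR] at i2 i3 i4
  push_cast at i2 i3 i4
  rw [exchangeConstant, hK]
  linear_combination 5 / 6 * i1 + 1 / 2 * i2 + i3 + 2 / 3 * i4 + 3 / 2 * i5 +
    1 / 2 * rowG - 1 / 2 * rowR

theorem colorSites_comp_swap {N : ℕ} {s : Fin N → Color} {α β : Fin N} {σ : Color}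
    (hα : s α = σ) (hβ : s β ≠ σ) :
    colorSites (s ∘ Equiv.swap α β) σ = insert β ((colorSites s σ).erase α) := by
  have hne : α ≠ β := fun h => hβ (h ▸ hα)
  ext γ
  simp only [mem_colorSites, Function.comp_apply, Finset.mem_insert, Finset.mem_erase]
  by_cases h1 : γ = α
  · subst h1
    simp [hβ, hne]
  by_cases h2 : γ = β
  · subst h2
    simp [hα]
  simp [h1, h2, Equiv.swap_apply_of_ne_of_ne h1 h2]

theorem colorSites_comp_swap_of_ne {N : ℕ} {s : Fin N → Color} {α β : Fin N} {σ : Color}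
    (hα : s α ≠ σ) (hβ : s β ≠ σ) :
    colorSites (s ∘ Equiv.swap α β) σ = colorSites s σ := by
  ext γ
  simp only [mem_colorSites, Function.comp_apply]
  by_cases h1 : γ = α
  · subst h1
    simp [hα, hβ]
  by_cases h2 : γ = β
  · subst h2
    simp [hα, hβ]
  rw [Equiv.swap_apply_of_ne_of_ne h1 h2]

theorem comp_swap_of_eq {N : ℕ} {s : Fin N → Color} {α β : Fin N} (h : s α = s β) :
    s ∘ Equiv.swap α β = s := by
  funext γ
  by_cases h1 : γ = α
  · subst h1
    simp [h]
  by_cases h2 : γ = β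
  · subst h2
    simp [h]
  simp [Equiv.swap_apply_of_ne_of_ne h1 h2]

theorem card_colorSites_comp {N : ℕ} (s : Fin N → Color) (e : Equiv.Perm (Fin N)) (σ : Color) :
    (colorSites (s ∘ e) σ).card = (colorSites s σ).card :=
  Finset.card_bij (fun α _ => e α) (fun α h => by simpa using h) (fun α _ β _ h => e.injective h)
    (fun β h => ⟨e.symm β, by simpa using h, by simp⟩)

/-- The amplitude at the configuration `s` as a polynomial in the position of the coloron. Its
coefficients are the amplitudes of the states `|Ψ_n⟩`, up to a common factor. -/
noncomputable def amplitudePoly (N M₁ M₂ : ℕ) (s : Fin N → Color) : ℂ[X] :=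
  if (colorSites s blue).card = M₁ ∧ (colorSites s red).card = M₂ then
    C (baseAmplitude N (colorSites s blue) (colorSites s red)) *
      ∏ b ∈ colorSites s blue, (X - C (eta N b))
  else 0

theorem eval_amplitudePoly {N M₁ M₂ : ℕ} {s : Fin N → Color}
    (h : (colorSites s blue).card = M₁ ∧ (colorSites s red).card = M₂) (x : ℂ) :
    (amplitudePoly N M₁ M₂ s).eval x =
      colorAmplitude N x (colorSites s blue) (colorSites s red) := by
  rw [amplitudePoly, if_pos h, colorAmplitude, eval_mul, eval_C, eval_prod]
  simp

theorem amplitudePoly_comp_eq_zero {N M₁ M₂ : ℕ} {s : Fin N → Color}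
    (h : ¬((colorSites s blue).card = M₁ ∧ (colorSites s red).card = M₂))
    (e : Equiv.Perm (Fin N)) : amplitudePoly N M₁ M₂ (s ∘ e) = 0 := by
  rw [amplitudePoly, if_neg]
  simpa only [card_colorSites_comp] using h

/-- The weighted sum of all color exchanges, for a coloron at a position `x` which is not a site. -/
theorem sum_pairWeight_mul_eval_amplitudePoly {N m : ℕ} (hN : 3 * m + 2 = N) {x : ℂ}
    (hx : ∀ α, eta N α ≠ x) {s : Fin N → Color}
    (hs : (colorSites s blue).card = m ∧ (colorSites s red).card = m + 1) :
    ∑ α : Fin N, ∑ β : Fin N, pairWeight (eta N α) (eta N β) *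
        (amplitudePoly N m (m + 1) (s ∘ Equiv.swap α β)).eval x =
      (amplitudePoly N m (m + 1) s).eval x * (2 * exchangeConstant N m +
        3 * ((m : ℂ) ^ 2 / 4 - ∑ α ∈ colorSites s blue, pairWeight (eta N α) x -
      (∑ α ∈ colorSites s blue, cotKernel (eta N α) x) ^ 2)) := by
  have hs' : ∀ α β, (colorSites (s ∘ Equiv.swap α β) blue).card = m ∧
      (colorSites (s ∘ Equiv.swap α β) red).card = m + 1 := fun α β => by
    rw [card_colorSites_comp, card_colorSites_comp]
    exact hs
  have hG : (colorSites s green).card = m + 1 := by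
    have := sum_card_colorSites s
    omega
  have hdisj : ∀ {σ τ : Color}, σ ≠ τ → Disjoint (colorSites s σ) (colorSites s τ) := by
    intro σ τ h
    rw [Finset.disjoint_left]
    intro α h1 h2
    rw [mem_colorSites] at h1 h2
    exact h (h1.symm.trans h2)
  have hU : colorSites s blue ∪ colorSites s red ∪ colorSites s green = Finset.univ := by
    ext α
    simp only [Finset.mem_union, mem_colorSites, Finset.mem_univ, iff_true]
    generalize s α = σ
    fin_cases σ <;> simp
  have hGc : (colorSites s blue ∪ colorSites s red)ᶜ = colorSites s green := by
    ext α
    simp only [Finset.mem_compl, Finset.mem_union, mem_colorSites]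
    generalize s α = σ
    fin_cases σ <;> decide
  have hBR : Disjoint (colorSites s blue) (colorSites s red) := hdisj (by decide)
  have hBG : Disjoint (colorSites s blue) (colorSites s green) := hdisj (by decide)
  have hRG : Disjoint (colorSites s red) (colorSites s green) := hdisj (by decide)
  simp only [eval_amplitudePoly (hs' _ _)]
  rw [eval_amplitudePoly hs]
  set F : Fin N → Fin N → ℂ := fun α β => pairWeight (eta N α) (eta N β) *
    colorAmplitude N x (colorSites (s ∘ Equiv.swap α β) blue)
      (colorSites (s ∘ Equiv.swap α β) red) with hF
  have hFcomm : ∀ S T : Finset (Fin N), ∑ α ∈ S, ∑ β ∈ T, F α β = ∑ α ∈ T, ∑ β ∈ S, F α β := by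
    intro S T
    rw [Finset.sum_comm]
    refine Finset.sum_congr rfl fun a _ => Finset.sum_congr rfl fun b _ => ?_
    simp only [hF]
    rw [pairWeight_comm, Equiv.swap_comm]
  have hsplit : ∀ f : Fin N → ℂ, ∑ β : Fin N, f β = ∑ β ∈ colorSites s blue, f β +
      ∑ β ∈ colorSites s red, f β + ∑ β ∈ colorSites s green, f β := by
    intro f
    rw [← hU, Finset.sum_union (Finset.disjoint_union_left.mpr ⟨hBG, hRG⟩), Finset.sum_union hBR]
  have hsame : ∀ σ : Color, ∑ α ∈ colorSites s σ, ∑ β ∈ colorSites s σ, F α β =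
      colorAmplitude N x (colorSites s blue) (colorSites s red) *
        ∑ α ∈ colorSites s σ, ∑ β ∈ colorSites s σ, pairWeight (eta N α) (eta N β) := by
    intro σ
    simp only [Finset.mul_sum]
    refine Finset.sum_congr rfl fun α hα => Finset.sum_congr rfl fun β hβ => ?_
    rw [mem_colorSites] at hα hβ
    simp only [hF]
    rw [comp_swap_of_eq (hα.trans hβ.symm)]
    ring
  have hopBG := fun α (hα : α ∈ colorSites s blue) =>
    sum_pairWeight_mul_hop_blue hx hBR (by rw [hs.1, hs.2]; omega) hα
  have hopBR := fun α (hα : α ∈ colorSites s blue) =>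
    sum_pairWeight_mul_exchange hx hBR hBG hRG hU hs.2 hG (by rw [hs.1]; omega) hα
  have hopRG := fun α (hα : α ∈ colorSites s red) =>
    sum_pairWeight_mul_hop_red x hBR (by rw [hs.1, hs.2]; omega) hα
  rw [hGc] at hopBG hopRG
  have hBGsum : ∀ α ∈ colorSites s blue, ∑ β ∈ colorSites s green, F α β =
      ∑ β ∈ colorSites s green, pairWeight (eta N α) (eta N β) *
        colorAmplitude N x (insert β ((colorSites s blue).erase α)) (colorSites s red) := by
    refine fun α hα => Finset.sum_congr rfl fun β hβ => ?_
    rw [mem_colorSites] at hα hβ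
    simp only [hF]
    rw [colorSites_comp_swap hα (by rw [hβ]; decide),
      colorSites_comp_swap_of_ne (by rw [hα]; decide) (by rw [hβ]; decide)]
  have hBRsum : ∀ α ∈ colorSites s blue, ∑ β ∈ colorSites s red, F α β =
      ∑ β ∈ colorSites s red, pairWeight (eta N α) (eta N β) *
        colorAmplitude N x (insert β ((colorSites s blue).erase α))
          (insert α ((colorSites s red).erase β)) := by
    refine fun α hα => Finset.sum_congr rfl fun β hβ => ?_
    rw [mem_colorSites] at hα hβ
    simp only [hF]
    rw [colorSites_comp_swap hα (by rw [hβ]; decide), Equiv.swap_comm,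
      colorSites_comp_swap hβ (by rw [hα]; decide)]
  have hRGsum : ∀ α ∈ colorSites s red, ∑ β ∈ colorSites s green, F α β =
      ∑ β ∈ colorSites s green, pairWeight (eta N α) (eta N β) *
        colorAmplitude N x (colorSites s blue) (insert β ((colorSites s red).erase α)) := by
    refine fun α hα => Finset.sum_congr rfl fun β hβ => ?_
    rw [mem_colorSites] at hα hβ
    simp only [hF]
    rw [colorSites_comp_swap hα (by rw [hβ]; decide),
      colorSites_comp_swap_of_ne (by rw [hα]; decide) (by rw [hβ]; decide)]
  have h1 := (Finset.sum_congr rfl hBGsum).trans (Finset.sum_congr rfl hopBG)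
  have h2 := (Finset.sum_congr rfl hBRsum).trans (Finset.sum_congr rfl hopBR)
  have h3 := (Finset.sum_congr rfl hRGsum).trans (Finset.sum_congr rfl hopRG)
  rw [← Finset.mul_sum] at h1 h2 h3
  have h4 := sum_hop_eq hx hBR hBG hRG hU hs.1 hs.2 hG _ rfl
  simp only [hsplit, Finset.sum_add_distrib]
  rw [hFcomm (colorSites s red) (colorSites s blue),
    hFcomm (colorSites s green) (colorSites s blue),
    hFcomm (colorSites s green) (colorSites s red), hsame, hsame, hsame, h1, h2, h3]
  linear_combination 2 * colorAmplitude N x (colorSites s blue) (colorSites s red) * h4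

/-- Both sides are polynomials in the position of the coloron which agree away from the sites. -/
theorem sum_pairWeight_mul_amplitudePoly {N m : ℕ} (hN : 3 * m + 2 = N) (s : Fin N → Color) :
    ∑ α : Fin N, ∑ β : Fin N, C (pairWeight (eta N α) (eta N β)) *
        amplitudePoly N m (m + 1) (s ∘ Equiv.swap α β) =
      C (2 * exchangeConstant N m) * amplitudePoly N m (m + 1) s +
        C 3 * (C (m : ℂ) * euler (amplitudePoly N m (m + 1) s) -
          euler (euler (amplitudePoly N m (m + 1) s))) := by
  by_cases hs : (colorSites s blue).card = m ∧ (colorSites s red).card = m + 1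
  swap
  · have h0 := amplitudePoly_comp_eq_zero hs (Equiv.refl _)
    rw [Equiv.coe_refl, Function.comp_id] at h0
    simp [amplitudePoly_comp_eq_zero hs, h0, euler]
  refine eq_of_infinite_eval_eq _ _ (Set.Infinite.mono (s := (Set.range (eta N))ᶜ) ?_
    (Set.finite_range _).infinite_compl)
  intro x hx'
  have hx : ∀ α, eta N α ≠ x := fun α h => hx' ⟨α, h⟩
  rw [Set.mem_ofPred_eq]
  simp only [eval_finsetSum, eval_mul, eval_C, eval_add, eval_sub]
  rw [sum_pairWeight_mul_eval_amplitudePoly hN hx hs]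
  obtain ⟨e1, e2⟩ := euler_prod_X_sub_C ((colorSites s blue).val.map (eta N)) x (by
    intro r hr
    obtain ⟨b, -, rfl⟩ := Multiset.mem_map.mp hr
    exact (hx b).symm)
  rw [Multiset.map_map, Multiset.map_map] at e1
  rw [Multiset.map_map, Multiset.map_map, Multiset.map_map] at e2
  change eval x (euler (∏ b ∈ colorSites s blue, (X - C (eta N b)))) =
    eval x (∏ b ∈ colorSites s blue, (X - C (eta N b))) *
      ∑ b ∈ colorSites s blue, (cotKernel x (eta N b) + 1 / 2) at e1
  change eval x (euler (euler (∏ b ∈ colorSites s blue, (X - C (eta N b))))) =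
    eval x (∏ b ∈ colorSites s blue, (X - C (eta N b))) *
      ((∑ b ∈ colorSites s blue, (cotKernel x (eta N b) + 1 / 2)) ^ 2 +
        ∑ b ∈ colorSites s blue, pairWeight x (eta N b)) at e2
  have e3 : ∑ b ∈ colorSites s blue, (cotKernel x (eta N b) + 1 / 2) =
      -∑ b ∈ colorSites s blue, cotKernel (eta N b) x + (m : ℂ) / 2 := by
    rw [Finset.sum_add_distrib, Finset.sum_const, hs.1, nsmul_eq_mul, ← Finset.sum_neg_distrib]
    congr 1
    · exact Finset.sum_congr rfl fun b _ => cotKernel_swap _ _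
    · ring
  have e4 : ∑ b ∈ colorSites s blue, pairWeight x (eta N b) =
      ∑ b ∈ colorSites s blue, pairWeight (eta N b) x :=
    Finset.sum_congr rfl fun b _ => pairWeight_comm _ _
  rw [e3] at e1
  rw [e3, e4] at e2
  simp only [amplitudePoly, if_pos hs, euler_C_mul, eval_mul, eval_C, e1, e2]
  ring

theorem ket_coloron_eq {N m n : ℕ} (hN : 3 * m + 2 = N) (hn : n ≤ m) (s : Fin N → Color) :
    ket N (coloron N n : (Fin m → ℂ) → (Fin (m + 1) → ℂ) → ℂ) s =
      pairSign m * pairSign (m + 1) * (amplitudePoly N m (m + 1) s).coeff n := by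
  rw [ket_coloron_apply (by omega) (by omega), amplitudePoly]
  split_ifs
  · rw [coeff_C_mul]
    ring
  · simp

theorem coloronEnergy_eq {N m n : ℕ} (hN : 3 * m + 2 = N) :
    coloronEnergy N n = -(Real.pi ^ 2 / 18) * ((N : ℝ) + 1 / N + 2 / (N : ℝ) ^ 2) +
      3 * Real.pi ^ 2 / (N : ℝ) ^ 2 * (((m : ℝ) - n) * n) := by
  have h : (N : ℝ) = 3 * m + 2 := by exact_mod_cast hN.symm
  have h0 : (3 * (m : ℝ) + 2) ≠ 0 := by positivity
  rw [coloronEnergy, groundEnergy, dispersion, coloronMomentum, h]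
  field_simp
  ring

theorem hamiltonian_ket_coloron {N m n : ℕ} (hN : 3 * m + 2 = N) (hn : n ≤ m) :
    hamiltonian N (ket N (coloron N n : (Fin m → ℂ) → (Fin (m + 1) → ℂ) → ℂ)) =
      ((coloronEnergy N n : ℝ) : ℂ) •
        ket N (coloron N n : (Fin m → ℂ) → (Fin (m + 1) → ℂ) → ℂ) := by
  funext s
  have h1 := congrArg (fun p => coeff p n) (sum_pairWeight_mul_amplitudePoly hN s)
  simp only [finsetSum_coeff, coeff_C_mul, coeff_add, coeff_sub, coeff_euler] at h1
  have h2 : ∑ α : Fin N, ∑ β : Fin N, pairWeight (eta N α) (eta N β) *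
      (pairSign m * pairSign (m + 1) * (amplitudePoly N m (m + 1) (s ∘ Equiv.swap α β)).coeff n) =
      pairSign m * pairSign (m + 1) * ∑ α : Fin N, ∑ β : Fin N, pairWeight (eta N α) (eta N β) *
        (amplitudePoly N m (m + 1) (s ∘ Equiv.swap α β)).coeff n := by
    simp only [Finset.mul_sum]
    exact Finset.sum_congr rfl fun α _ => Finset.sum_congr rfl fun β _ => by ring
  rw [hamiltonian_apply, Pi.smul_apply, smul_eq_mul]
  simp only [ket_coloron_eq hN hn]
  rw [h2, h1]
  simp only [← Finset.sum_mul, sum_pairWeight]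
  rw [Finset.sum_const, Finset.card_univ, Fintype.card_fin, nsmul_eq_mul, coloronEnergy_eq hN,
    exchangeConstant]
  have h : (N : ℂ) = 3 * m + 2 := by exact_mod_cast hN.symm
  have h0 : (3 * (m : ℂ) + 2) ≠ 0 := by
    rw [← h]
    exact_mod_cast (by omega : N ≠ 0)
  push_cast
  rw [h]
  field_simp
  ring

end HaldaneShastry

open HaldaneShastry in
theorem mainTheorem1 (N M M₁ M₂ : ℕ) (hN : N + 1 = 3 * M)
    (hM₁ : 3 * M₁ + 2 = N) (hM₂ : 3 * M₂ = N + 1) :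
    (∀ n : ℕ, n ≤ M₁ →
      HasMomentum N (coloron N n : (Fin M₁ → ℂ) → (Fin M₂ → ℂ) → ℂ) (coloronMomentum N n) ∧
      (hamiltonian N).HasEigenvector ((coloronEnergy N n : ℝ) : ℂ)
        (ket N (coloron N n : (Fin M₁ → ℂ) → (Fin M₂ → ℂ) → ℂ)) ∧
      coloronEnergy N n =
        -(Real.pi ^ 2 / 18) * ((N : ℝ) + 1 / N + 2 / (N : ℝ) ^ 2) +
          3 * Real.pi ^ 2 / (N : ℝ) ^ 2 * (((M₁ : ℝ) - n) * n)) ∧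
    (∀ n : ℕ, M₁ < n → n < N →
      ∀ (z : Fin M₁ → ℂ) (w : Fin M₂ → ℂ), coloron N n z w = 0) := by
  refine ⟨fun n hn => ⟨coloron_hasMomentum hN hM₁ hM₂ hn, ?_, coloronEnergy_eq hM₁⟩,
    fun n hn hnN z w => coloron_eq_zero hn hnN z w⟩
  obtain rfl : M₂ = M₁ + 1 := by omega
  exact ⟨Module.End.mem_eigenspace_iff.mpr (hamiltonian_ket_coloron hM₁ hn),
    ket_coloron_ne_zero (by omega) (by omega) hn⟩
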